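/- All graphs are finite and simple. For a graph $G$, let $i(G)$ be its independent domination number, i.e. the minimum size of an independent set $S\subseteq V(G)$ such that every vertex not in $S$ has a neighbor in $S$, and let $n_j(G)$ be the number of vertices of degree $j$ in $G$. A graph is subcubic if every vertex has degree at most $3$. **Theorem.** If $G$ is a subcubic graph without $4$-cycles (that is, with no cycle of length $4$ as a subgraph, induced or not), then $$14\,i(G)\le 14\,n_0(G)+9\,n_1(G)+6\,n_2(G)+5\,n_3(G).$$ The bound is tight for infinitely many connected graphs: for non-negative integers $k,\ell$ with $k+\ell\ge 5$, let $T_{k,\ell}$ be the graph obtained from a cycle $x_1x_2\cdots x_{k+4\ell}x_1$ by adding a pendent vertex to each of $x_1,\dots,x_k$ and, for each $j\in\{0,\dots,\ell-1\}$, adding a new vertex adjacent exactly to $x_{k+4j+1}$ and $x_{k+4j+4}$. Then $T_{k,\ell}$ is a connected subcubic graph without $4$-cycles, with $n_0(T_{k,\ell})=0$, $n_1(T_{k,\ell})=k$, $n_2(T_{k,\ell})=3\ell$, $n_3(T_{k,\ell})=k+2\ell$ and $i(T_{k,\ell})=k+2\ell$; hence $$14\,i(T_{k,\ell})= 14\,n_0(T_{k,\ell})+9\,n_1(T_{k,\ell})+6\,n_2(T_{k,\ell})+5\,n_3(T_{k,\ell}).$$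 -/

import Mathlib

namespace SimpleGraph

/-- `S` is a dominating set of `G`: each vertex not in `S` has a neighbor in `S`. -/
def IsDominatingSet {V : Type*} (G : SimpleGraph V) (S : Finset V) : Prop :=
  ∀ v, v ∉ S → ∃ w ∈ S, G.Adj v w

/-- `S` is an independent dominating set of `G`. -/
def IsIndepDominatingSet {V : Type*} (G : SimpleGraph V) (S : Finset V) : Prop :=
  G.IsDominatingSet S ∧ G.IsIndepSet (S : Set V)

/-- Every finite graph has an independent dominating set, so the minimum in the definition of
the independent domination number is over a nonempty set. -/
theorem exists_isIndepDominatingSet {V : Type*} [Finite V] (G : SimpleGraph V) :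
    ∃ S : Finset V, G.IsIndepDominatingSet S := by
  classical
  obtain ⟨S, hS⟩ := (Set.toFinite {S : Finset V | G.IsIndepSet (S : Set V)}).exists_maximal
    ⟨∅, by simp [IsIndepSet]⟩
  refine ⟨S, fun v hv => ?_, hS.prop⟩
  by_contra! h
  have h2 : G.IsIndepSet ((insert v S : Finset V) : Set V) := by
    rw [Finset.coe_insert]
    exact hS.prop.insert fun b hb _ => ⟨h b hb, fun hbv => h b hb hbv.symm⟩
  exact hv (hS.le_of_ge h2 (Finset.subset_insert v S) (Finset.mem_insert_self v S))

/-- The independent domination number `i(G)` of a finite graph `G`: the minimum size of an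
independent dominating set of `G`. -/
noncomputable def indepDominationNumber {V : Type*} [Finite V] (G : SimpleGraph V) : ℕ :=
  sInf {n : ℕ | ∃ S : Finset V, G.IsIndepDominatingSet S ∧ S.card = n}

/-- `n_j(G)`: the number of vertices of degree `j` in `G`. -/
def numVertsOfDegree {V : Type*} [Fintype V] (G : SimpleGraph V) [DecidableRel G.Adj]
    (j : ℕ) : ℕ :=
  (Finset.univ.filter fun v => G.degree v = j).card

/-- A graph is subcubic if every vertex has degree at most `3`. -/
def IsSubcubic {V : Type*} [Fintype V] (G : SimpleGraph V) [DecidableRel G.Adj] : Prop :=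
  ∀ v, G.degree v ≤ 3

/-- `G` has no cycle of length `4` (as a not necessarily induced subgraph). -/
def HasNoFourCycle {V : Type*} (G : SimpleGraph V) : Prop :=
  ∀ (v : V) (p : G.Walk v v), p.IsCycle → p.length ≠ 4

/-- The vertices of `T_{k,ℓ}`: the vertices of a cycle of length `k + 4ℓ`, then `k` pendent
vertices, then `ℓ` further vertices. -/
abbrev TVertex (k l : ℕ) : Type := Fin (k + 4 * l) ⊕ (Fin k ⊕ Fin l)

/-- The edges of `T_{k,ℓ}`, each in at least one direction. The cycle vertex `x_m` (numbered from
`1`) is `m - 1 : Fin (k + 4ℓ)`. The `j`-th pendent vertex is joined to `x_{j+1}` for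
`0 ≤ j < k`, and the `i`-th further vertex to `x_{k+4i+1}` and `x_{k+4i+4}` for `0 ≤ i < ℓ`. -/
def TRel (k l : ℕ) : TVertex k l → TVertex k l → Prop
  | .inl a, .inl b => (cycleGraph (k + 4 * l)).Adj a b
  | .inr (.inl j), .inl a => a.val = j.val
  | .inr (.inr i), .inl a => a.val = k + 4 * i.val ∨ a.val = k + 4 * i.val + 3
  | _, _ => False

instance (k l : ℕ) : DecidableRel (TRel k l)
  | .inl a, .inl b => inferInstanceAs (Decidable ((cycleGraph (k + 4 * l)).Adj a b))
  | .inr (.inl j), .inl a => inferInstanceAs (Decidable (a.val = j.val))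
  | .inr (.inr i), .inl a =>
    inferInstanceAs (Decidable (a.val = k + 4 * i.val ∨ a.val = k + 4 * i.val + 3))
  | .inl _, .inr _ => inferInstanceAs (Decidable False)
  | .inr (.inl _), .inr _ => inferInstanceAs (Decidable False)
  | .inr (.inr _), .inr _ => inferInstanceAs (Decidable False)

/-- The graph `T_{k,ℓ}` (of interest for `k + ℓ ≥ 5`). -/
def T (k l : ℕ) : SimpleGraph (TVertex k l) := fromRel (TRel k l)

instance (k l : ℕ) : DecidableRel (T k l).Adj :=
  inferInstanceAs (DecidableRel (fromRel (TRel k l)).Adj)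

end SimpleGraph

/-! Give a vertex of degree d the weight 5 + (3 - d)^2, that is 14, 9, 6, 5; the bound then reads 14
i(G) ≤ w(G). Take a counterexample all of whose proper induced subgraphs satisfy it. If S is
independent and U = N[S], then S together with a light independent dominating set of G - U is
independent and dominating in G. Hence 14|S| plus the weight gained outside U must exceed w(U). This
inequality (`reduce`) excludes every local configuration below. The first neighbor lost by a vertex
of degree 1, 2, 3 costs 5, 3, 1, and each further loss at the same vertex costs 2 more than the
previous one. Without 4-cycles, no vertex is hit twice when S is a single vertex.

Singletons S show that the other neighbors of a leaf's neighbor have degree three and are heavy: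
their remaining neighbors have degrees 1, 3 or 2, 2. Larger sets S show that no three vertices of
degree two are consecutive and that two adjacent ones lie in a five-cycle (`PairEnd.p_eq`) whose two
outgoing edges lead to heavy vertices.

Local reductions cannot go further, because pendent edges and such five-cycles weigh exactly 14 per
vertex of S. Every heavy vertex lies in such a tile, however, so disjoint tiles can be collected
until no edge leaves their union, and then nothing is lost (`tile_family_false`). So there are no
leaves and no adjacent vertices of degree two. The same argument with the tiles N[x], where x has
degree two, leaves a cubic graph, where a closed neighborhood weighs 20 = 14 + 6.

The graphs T are assembled from the tight tiles. A dominating set needs one vertex in each pendent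
edge and two in each five-cycle; the matching upper bound on i(T) is the inequality itself. -/

namespace SimpleGraph

set_option linter.unusedSectionVars false

/-! ### Weights and the reduction inequality. -/

section LocalReduction

variable {V : Type*} [Fintype V] [DecidableEq V] {G : SimpleGraph V} [DecidableRel G.Adj]

/-- The weight of a vertex of degree `d` in a subcubic graph: `14, 9, 6, 5` for `d = 0, 1, 2, 3`. -/
def degWeight (d : ℕ) : ℕ := 5 + (3 - d) ^ 2

/-- The increase of the total weight when each entry of the list loses one neighbor
(with multiplicity), for vertices with degrees `d`. -/
def hitCost (d : V → ℕ) : List V → ℕ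
  | [] => 0
  | z :: L => (7 - 2 * d z) + 2 * L.count z + hitCost d L

/-- With deficiency e = 3 - d, losing c neighbors adds (e + c)^2 - e^2 = c^2 + 2ec, and the next
loss adds 2e + 1 + 2c. The latter is 7 - 2d + 2c, without truncation because d ≤ 3. So the order of
the list is irrelevant. -/
theorem hitCost_eq_sum {d : V → ℕ} (hd : ∀ v, d v ≤ 3) (L : List V) :
    hitCost d L = ∑ v, (L.count v ^ 2 + 2 * (3 - d v) * L.count v) := by
  induction L with
  | nil => simp [hitCost]
  | cons z L ih =>
    rw [hitCost, ih, ← Finset.add_sum_erase _ _ (Finset.mem_univ z),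
      ← Finset.add_sum_erase Finset.univ (fun v => (z :: L).count v ^ 2 +
        2 * (3 - d v) * (z :: L).count v) (Finset.mem_univ z)]
    have h : ∀ v ∈ Finset.univ.erase z, ((z :: L).count v ^ 2 +
        2 * (3 - d v) * (z :: L).count v) = L.count v ^ 2 + 2 * (3 - d v) * L.count v := by
      intro v hv
      rw [List.count_cons_of_ne (Finset.ne_of_mem_erase hv).symm]
    rw [Finset.sum_congr rfl h]
    simp only [List.count_cons_self]
    obtain ⟨e, he⟩ := Nat.exists_eq_add_of_le (hd z)
    have h1 : 7 - 2 * d z = 1 + 2 * e := by omega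
    have h2 : 3 - d z = e := by omega
    rw [h1, h2]
    ring

/-- A subcubic graph without 4-cycles that violates the weighted bound, while all of its proper
induced subgraphs satisfy it. -/
structure IsMinCounterexample (G : SimpleGraph V) [DecidableRel G.Adj] : Prop where
  degree_le : ∀ v, G.degree v ≤ 3
  c4 : ∀ a b c d, G.Adj a b → G.Adj b c → G.Adj c d → G.Adj d a → a = c ∨ b = d
  not_light : ∀ D : Finset V, G.IsIndepDominatingSet D →
    ∑ v, degWeight (G.degree v) < 14 * D.card
  smaller : ∀ U : Finset V, U.Nonempty → ∃ D : Finset V, Disjoint D U ∧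
    (∀ v ∈ D, ∀ w ∈ D, ¬ G.Adj v w) ∧ (∀ v, v ∉ U → v ∉ D → ∃ w ∈ D, G.Adj v w) ∧
    14 * D.card ≤ ∑ v ∈ Uᶜ, degWeight (G.neighborFinset v \ U).card

/-- The light set D of G - U has no edge to S, since all neighbors of S lie in U; so S ∪ D
contradicts `not_light`. The list L may overcount the edges leaving U, because the weight gain is
monotone in the number of losses. -/
theorem IsMinCounterexample.reduce_finset (h : G.IsMinCounterexample) (S U : Finset V) (L : List V)
    (hne : U.Nonempty) (hSU : S ⊆ U) (hind : ∀ s ∈ S, ∀ t ∈ S, ¬ G.Adj s t)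
    (hcl : ∀ s ∈ S, ∀ z, G.Adj s z → z ∈ U) (hdom : ∀ u ∈ U, u ∈ S ∨ ∃ s ∈ S, G.Adj u s)
    (hL : ∀ v ∉ U, (G.neighborFinset v ∩ U).card ≤ L.count v)
    (hw : 14 * S.card + hitCost (fun v => G.degree v) L ≤ ∑ u ∈ U, degWeight (G.degree u)) : False := by
  obtain ⟨D, hDU, hDind, hDdom, hD⟩ := h.smaller U hne
  have hnot : ∀ v ∈ D, v ∉ U := fun v hv => Finset.disjoint_left.1 hDU hv
  have hSD : Disjoint S D := (hDU.mono_right hSU).symm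
  have key := h.not_light (S ∪ D) ⟨by
    intro v hv
    rw [Finset.mem_union, not_or] at hv
    by_cases hvU : v ∈ U
    · rcases hdom v hvU with h1 | ⟨s, hs, h1⟩
      · exact absurd h1 hv.1
      · exact ⟨s, Finset.mem_union_left _ hs, h1⟩
    · obtain ⟨w, hw, h1⟩ := hDdom v hvU hv.2
      exact ⟨w, Finset.mem_union_right _ hw, h1⟩, by
    intro v hv w hw _ hvw
    rw [Finset.mem_coe, Finset.mem_union] at hv hw
    rcases hv with hv | hv <;> rcases hw with hw | hw
    · exact hind v hv w hw hvw
    · exact hnot w hw (hcl v hv w hvw)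
    · exact hnot v hv (hcl w hw v hvw.symm)
    · exact hDind v hv w hw hvw⟩
  rw [Finset.card_union_of_disjoint hSD] at key
  have h1 : ∑ v ∈ Uᶜ, degWeight (G.neighborFinset v \ U).card ≤
      ∑ v ∈ Uᶜ, (degWeight (G.degree v) +
        (L.count v ^ 2 + 2 * (3 - G.degree v) * L.count v)) := by
    refine Finset.sum_le_sum fun v hv => ?_
    have h2 := hL v (Finset.mem_compl.1 hv)
    have h3 : (G.neighborFinset v \ U).card + (G.neighborFinset v ∩ U).card = G.degree v := by
      rw [Finset.card_sdiff_add_card_inter, card_neighborFinset_eq_degree]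
    obtain ⟨e, he⟩ := Nat.exists_eq_add_of_le (h.degree_le v)
    set a := (G.neighborFinset v \ U).card
    set b := (G.neighborFinset v ∩ U).card
    have h4 : 3 - a = e + b := by omega
    have h5 : 3 - G.degree v = e := by omega
    rw [degWeight, degWeight, h4, h5]
    have h6 : b ^ 2 ≤ L.count v ^ 2 := Nat.pow_le_pow_left h2 2
    have h7 : e * b ≤ e * L.count v := Nat.mul_le_mul_left e h2
    nlinarith
  rw [Finset.sum_add_distrib] at h1
  have h2 : ∑ v ∈ Uᶜ, (L.count v ^ 2 + 2 * (3 - G.degree v) * L.count v) ≤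
      hitCost (fun v => G.degree v) L := by
    rw [hitCost_eq_sum (fun v => h.degree_le v)]
    exact Finset.sum_le_sum_of_subset (Finset.subset_univ _)
  have h3 := Finset.sum_add_sum_compl U fun v => degWeight (G.degree v)
  omega

/-- The main reduction, with `S` and `U = N[S]` given as lists, and `E` listing the edges that
leave `U`. -/
theorem IsMinCounterexample.reduce (h : G.IsMinCounterexample) (S U : List V) (E : List (V × V))
    (hne : U ≠ []) (hU : U.Nodup) (hSU : ∀ s ∈ S, s ∈ U)
    (hind : ∀ s ∈ S, ∀ t ∈ S, ¬ G.Adj s t)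
    (hcl : ∀ s ∈ S, ∀ z, G.Adj s z → z ∈ U) (hdom : ∀ u ∈ U, u ∈ S ∨ ∃ s ∈ S, G.Adj u s)
    (hE : ∀ u ∈ U, ∀ z, G.Adj u z → z ∈ U ∨ (u, z) ∈ E)
    (hw : 14 * S.length + hitCost (fun v => G.degree v) (E.map Prod.snd) ≤
      (U.map fun u => degWeight (G.degree u)).sum) : False := by
  refine h.reduce_finset S.toFinset U.toFinset (E.map Prod.snd) ?_ ?_ ?_ ?_ ?_ ?_ ?_
  · simpa [List.toFinset_nonempty_iff] using hne
  · intro s hs; simpa using hSU s (by simpa using hs)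
  · simpa using hind
  · simpa using hcl
  · simpa using hdom
  · intro v hv
    rw [List.mem_toFinset] at hv
    have h1 : ((G.neighborFinset v ∩ U.toFinset).image fun u => (u, v)) ⊆
        (E.filter fun e => e.2 = v).toFinset := by
      intro e he
      simp only [Finset.mem_image, Finset.mem_inter, mem_neighborFinset, List.mem_toFinset] at he
      obtain ⟨u, ⟨hvu, hu⟩, rfl⟩ := he
      have := (hE u hu v hvu.symm).resolve_left hv
      simpa using this
    have h2 := Finset.card_le_card h1
    rw [Finset.card_image_of_injective _ (fun a b hab => (Prod.mk.inj hab).1)] at h2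
    refine h2.trans ((List.toFinset_card_le _).trans ?_)
    rw [List.count, List.countP_map, List.countP_eq_length_filter]
    refine le_of_eq (congrArg List.length (List.filter_congr fun e _ => ?_))
    rw [Function.comp_apply, Bool.eq_iff_iff]
    simp
  · rw [List.sum_toFinset _ hU]
    have := List.toFinset_card_le S
    omega

end LocalReduction

/-! ### Explicit neighborhoods of vertices of degree one, two and three. -/

section Neighborhoods

variable {V : Type*} {G : SimpleGraph V} {u v a b c p q : V}

/-- `a` is the only neighbor of `v`. -/
structure Nbr1 (G : SimpleGraph V) (v a : V) : Prop where
  adj_iff : ∀ z, G.Adj v z ↔ z = a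

/-- `v` has exactly the two neighbors `a` and `b`. -/
structure Nbr2 (G : SimpleGraph V) (v a b : V) : Prop where
  ne : a ≠ b
  adj_iff : ∀ z, G.Adj v z ↔ z = a ∨ z = b

/-- `v` has exactly the three neighbors `a`, `b` and `c`. -/
structure Nbr3 (G : SimpleGraph V) (v a b c : V) : Prop where
  ne₁₂ : a ≠ b
  ne₁₃ : a ≠ c
  ne₂₃ : b ≠ c
  adj_iff : ∀ z, G.Adj v z ↔ z = a ∨ z = b ∨ z = c

theorem Nbr1.adj (h : G.Nbr1 v a) : G.Adj v a := (h.adj_iff a).2 rfl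

theorem Nbr2.adj₁ (h : G.Nbr2 v a b) : G.Adj v a := (h.adj_iff a).2 (.inl rfl)

theorem Nbr2.adj₂ (h : G.Nbr2 v a b) : G.Adj v b := (h.adj_iff b).2 (.inr rfl)

theorem Nbr2.symm (h : G.Nbr2 v a b) : G.Nbr2 v b a :=
  ⟨h.ne.symm, fun z => (h.adj_iff z).trans or_comm⟩

theorem Nbr3.adj₁ (h : G.Nbr3 v a b c) : G.Adj v a := (h.adj_iff a).2 (.inl rfl)

theorem Nbr3.adj₂ (h : G.Nbr3 v a b c) : G.Adj v b := (h.adj_iff b).2 (.inr (.inl rfl))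

theorem Nbr3.adj₃ (h : G.Nbr3 v a b c) : G.Adj v c := (h.adj_iff c).2 (.inr (.inr rfl))

theorem Nbr3.swap₂₃ (h : G.Nbr3 v a b c) : G.Nbr3 v a c b :=
  ⟨h.ne₁₃, h.ne₁₂, h.ne₂₃.symm, fun z => by rw [h.adj_iff]; tauto⟩

theorem Nbr3.swap₁₂ (h : G.Nbr3 v a b c) : G.Nbr3 v b a c :=
  ⟨h.ne₁₂.symm, h.ne₂₃, h.ne₁₃, fun z => by rw [h.adj_iff]; tauto⟩

theorem Nbr3.rotate (h : G.Nbr3 v a b c) : G.Nbr3 v c a b :=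
  h.swap₂₃.swap₁₂

variable [Fintype V] [DecidableEq V] [DecidableRel G.Adj]

theorem Nbr1.degree (h : G.Nbr1 v a) : G.degree v = 1 := by
  rw [← card_neighborFinset_eq_degree]
  have : G.neighborFinset v = {a} := by ext z; simp [h.adj_iff]
  rw [this, Finset.card_singleton]

theorem Nbr2.degree (h : G.Nbr2 v a b) : G.degree v = 2 := by
  rw [← card_neighborFinset_eq_degree]
  have : G.neighborFinset v = {a, b} := by ext z; simp [h.adj_iff]
  rw [this, Finset.card_pair h.ne]

theorem Nbr3.degree (h : G.Nbr3 v a b c) : G.degree v = 3 := by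
  rw [← card_neighborFinset_eq_degree]
  have : G.neighborFinset v = {a, b, c} := by ext z; simp [h.adj_iff]
  rw [this, Finset.card_eq_three]
  exact ⟨a, b, c, h.ne₁₂, h.ne₁₃, h.ne₂₃, rfl⟩

theorem exists_adj_of_degree_pos (h : 1 ≤ G.degree v) : ∃ a, G.Adj v a := by
  rw [← card_neighborFinset_eq_degree] at h
  obtain ⟨a, ha⟩ := Finset.card_pos.1 h
  exact ⟨a, by simpa using ha⟩

theorem nbr1_of_adj (h : G.degree v = 1) (ha : G.Adj v a) : G.Nbr1 v a := by
  rw [← card_neighborFinset_eq_degree, Finset.card_eq_one] at h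
  obtain ⟨x, hx⟩ := h
  have h1 : ∀ z, G.Adj v z ↔ z = x := fun z => by rw [← mem_neighborFinset, hx]; simp
  obtain rfl := (h1 a).1 ha
  exact ⟨h1⟩

theorem exists_nbr2 (h : G.degree v = 2) (ha : G.Adj v a) : ∃ b, G.Nbr2 v a b := by
  rw [← card_neighborFinset_eq_degree, Finset.card_eq_two] at h
  obtain ⟨x, y, hxy, hx⟩ := h
  have h1 : ∀ z, G.Adj v z ↔ z = x ∨ z = y := fun z => by rw [← mem_neighborFinset, hx]; simp
  have h2 : G.Nbr2 v x y := ⟨hxy, h1⟩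
  rcases (h1 a).1 ha with rfl | rfl
  · exact ⟨_, h2⟩
  · exact ⟨_, h2.symm⟩

theorem exists_nbr3 (h : G.degree v = 3) (ha : G.Adj v a) : ∃ b c, G.Nbr3 v a b c := by
  rw [← card_neighborFinset_eq_degree, Finset.card_eq_three] at h
  obtain ⟨x, y, w, hxy, hxw, hyw, hx⟩ := h
  have h1 : ∀ z, G.Adj v z ↔ z = x ∨ z = y ∨ z = w := fun z => by
    rw [← mem_neighborFinset, hx]; simp
  have h2 : G.Nbr3 v x y w := ⟨hxy, hxw, hyw, h1⟩
  rcases (h1 a).1 ha with rfl | rfl | rfl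
  · exact ⟨_, _, h2⟩
  · exact ⟨_, _, h2.swap₁₂⟩
  · exact ⟨_, _, h2.rotate⟩

theorem exists_nbr3_of_adj (h : G.degree v = 3) (ha : G.Adj v a) (hb : G.Adj v b) (hab : a ≠ b) :
    ∃ c, G.Nbr3 v a b c := by
  obtain ⟨x, y, h1⟩ := exists_nbr3 h ha
  rcases (h1.adj_iff b).1 hb with rfl | rfl | rfl
  · exact absurd rfl hab
  · exact ⟨_, h1⟩
  · exact ⟨_, h1.swap₂₃⟩

/-- The neighbors of `u` other than `v` and the neighbors of `v` all occur in the list `A`, whose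
entries are distinct neighbors of `u` other than `v`. -/
structure OutList (G : SimpleGraph V) (v u : V) (A : List V) : Prop where
  nodup : A.Nodup
  adj : ∀ z ∈ A, G.Adj u z ∧ z ≠ v
  cover : ∀ z, G.Adj u z → z = v ∨ G.Adj v z ∨ z ∈ A

theorem Nbr1.outList (h : G.Nbr1 u v) : G.OutList v u [] :=
  ⟨List.nodup_nil, by simp, fun z hz => .inl ((h.adj_iff z).1 hz)⟩

theorem Nbr2.outList (h : G.Nbr2 u v p) : G.OutList v u [p] :=
  ⟨List.nodup_singleton _, by simp [h.adj₂, h.ne.symm], fun z hz => by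
    rcases (h.adj_iff z).1 hz with rfl | rfl <;> simp⟩

theorem Nbr2.outList_of_adj (h : G.Nbr2 u v p) (hq : G.Adj u q) (hvq : G.Adj v q) :
    G.OutList v u [] :=
  ⟨List.nodup_nil, by simp, fun z hz => by
    rcases (h.adj_iff q).1 hq with rfl | rfl
    · exact absurd hvq (G.loopless.irrefl _)
    · rcases (h.adj_iff z).1 hz with rfl | rfl <;> simp [hvq]⟩

theorem Nbr3.outList (h : G.Nbr3 u v p q) : G.OutList v u [p, q] :=
  ⟨by simp [h.ne₂₃], by simp [h.adj₂, h.adj₃, h.ne₁₂.symm, h.ne₁₃.symm], fun z hz => by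
    rcases (h.adj_iff z).1 hz with rfl | rfl | rfl <;> simp⟩

theorem Nbr3.outList_triangle (h : G.Nbr3 u v p q) (hp : G.Adj v p) : G.OutList v u [q] :=
  ⟨by simp, by simp [h.adj₃, h.ne₁₃.symm], fun z hz => by
    rcases (h.adj_iff z).1 hz with rfl | rfl | rfl <;> simp [hp]⟩

end Neighborhoods

/-! ### Removing one closed neighborhood; leaves and their surroundings. -/

namespace IsMinCounterexample

variable {V : Type*} [Fintype V] [DecidableEq V] {G : SimpleGraph V} [DecidableRel G.Adj]
  {u v a b c p q r s t x y : V} {A B C : List V}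

theorem hitCost_of_nodup {L : List V} (hL : L.Nodup) (d : V → ℕ) :
    hitCost d L = (L.map fun z => 7 - 2 * d z).sum := by
  induction L with
  | nil => rfl
  | cons z L ih =>
    rw [List.nodup_cons] at hL
    simp [hitCost, ih hL.2, List.count_eq_zero_of_not_mem hL.1]

/-- Removing a single closed neighborhood `N[v]`, where `N` lists the neighbors of `v` together
with the lists of their outer neighbors. -/
theorem single (h : G.IsMinCounterexample) (N : List (V × List V)) (hN : (N.map Prod.fst).Nodup)
    (hv : ∀ z, G.Adj v z ↔ z ∈ N.map Prod.fst) (hout : ∀ e ∈ N, G.OutList v e.1 e.2) :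
    degWeight (G.degree v) + (N.map fun e => degWeight (G.degree e.1)).sum <
      14 + (N.map fun e => (e.2.map fun z => 7 - 2 * G.degree z).sum).sum := by
  by_contra! hlt
  have hvN : v ∉ N.map Prod.fst := fun h1 => G.loopless.irrefl v ((hv v).2 h1)
  refine h.reduce [v] (v :: N.map Prod.fst) (N.flatMap fun e => e.2.map fun z => (e.1, z)) (by simp)
    (List.nodup_cons.2 ⟨hvN, hN⟩) (by simp) (by simp) ?_ ?_ ?_ ?_
  · intro s hs z hz
    rw [List.mem_singleton] at hs
    subst hs
    exact List.mem_cons_of_mem _ ((hv z).1 hz)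
  · intro u hu
    rcases List.mem_cons.1 hu with rfl | hu
    · simp
    · exact .inr ⟨v, by simp, ((hv u).2 hu).symm⟩
  · intro u hu z hz
    rcases List.mem_cons.1 hu with rfl | hu
    · exact .inl (List.mem_cons_of_mem _ ((hv z).1 hz))
    · obtain ⟨e, he, rfl⟩ := List.mem_map.1 hu
      rcases (hout e he).cover z hz with rfl | h1 | h1
      · simp
      · exact .inl (List.mem_cons_of_mem _ ((hv z).1 h1))
      · exact .inr (List.mem_flatMap.2 ⟨e, he, List.mem_map.2 ⟨z, h1, rfl⟩⟩)
  · rw [hitCost_of_nodup]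
    · rw [List.map_flatMap, List.map_flatMap, List.flatMap_def, List.sum_flatten, List.map_map,
        List.map_cons, List.sum_cons, List.map_map]
      refine le_trans (le_of_eq ?_) hlt
      rw [List.length_singleton, mul_one]
      congr 2
      refine List.map_congr_left fun e _ => ?_
      simp [Function.comp_def]
    · rw [List.map_flatMap, List.nodup_flatMap]
      refine ⟨fun e he => by simpa [Function.comp_def] using (hout e he).nodup, ?_⟩
      have h1 : N.Pairwise fun e f => e.1 ≠ f.1 := List.pairwise_map.1 hN
      refine (List.pairwise_iff_forall_sublist.2 ?_)
      intro e f hef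
      have hne := List.pairwise_iff_forall_sublist.1 h1 hef
      have he : e ∈ N := hef.subset (by simp)
      have hf : f ∈ N := hef.subset (by simp)
      intro z hz1 hz2
      simp only [List.map_map, Function.comp_def, List.map_id'] at hz1 hz2
      have h2 := (hout e he).adj z hz1
      have h3 := (hout f hf).adj z hz2
      -- A vertex z seen from two neighbors of v would close a 4-cycle through v, so the list of
      -- hits has no repetition.
      rcases h.c4 v e.1 z f.1 ((hv _).2 (List.mem_map_of_mem he)) h2.1 h3.1.symm
        ((hv _).2 (List.mem_map_of_mem hf)).symm with h4 | h4
      · exact h2.2 h4.symm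
      · exact hne h4

theorem single1 (h : G.IsMinCounterexample) (hv : G.Nbr1 v a) (hA : G.OutList v a A) :
    9 + degWeight (G.degree a) < 14 + (A.map fun z => 7 - 2 * G.degree z).sum := by
  have := h.single (v := v) [(a, A)] (by simp) (by simp [hv.adj_iff]) (by simpa using hA)
  simpa [hv.degree, degWeight] using this

theorem single2 (h : G.IsMinCounterexample) (hv : G.Nbr2 v a b) (hA : G.OutList v a A)
    (hB : G.OutList v b B) :
    6 + degWeight (G.degree a) + degWeight (G.degree b) <
      14 + (A.map fun z => 7 - 2 * G.degree z).sum + (B.map fun z => 7 - 2 * G.degree z).sum := by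
  have := h.single (v := v) [(a, A), (b, B)] (by simp [hv.ne]) (by simp [hv.adj_iff])
    (by simpa using ⟨hA, hB⟩)
  simpa [hv.degree, degWeight, add_assoc] using this

theorem single3 (h : G.IsMinCounterexample) (hv : G.Nbr3 v a b c) (hA : G.OutList v a A)
    (hB : G.OutList v b B) (hC : G.OutList v c C) :
    5 + degWeight (G.degree a) + degWeight (G.degree b) + degWeight (G.degree c) <
      14 + (A.map fun z => 7 - 2 * G.degree z).sum + (B.map fun z => 7 - 2 * G.degree z).sum +
        (C.map fun z => 7 - 2 * G.degree z).sum := by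
  have := h.single (v := v) [(a, A), (b, B), (c, C)] (by simp [hv.ne₁₂, hv.ne₁₃, hv.ne₂₃])
    (by simp [hv.adj_iff]) (by simpa using ⟨hA, hB, hC⟩)
  simpa [hv.degree, degWeight, add_assoc] using this

theorem one_le_degree (h : G.IsMinCounterexample) (v : V) : 1 ≤ G.degree v := by
  by_contra hv
  have h0 : G.degree v = 0 := by omega
  have := h.single (v := v) [] (by simp) (fun z => by
    have : z ∉ G.neighborFinset v := by
      rw [Finset.card_eq_zero.1 ((G.card_neighborFinset_eq_degree v).trans h0)]; simp
    simpa using this) (by simp)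
  simp [h0, degWeight] at this

/-- `u` is the neighbor of `b` from which two further neighbors of `b` are seen, and these have
degrees `1, 3` or `2, 2`. -/
def Heavy (G : SimpleGraph V) [DecidableRel G.Adj] (u b : V) : Prop :=
  ∃ p q, G.Nbr3 b u p q ∧
    (G.degree p = 1 ∧ G.degree q = 3 ∨ G.degree p = 2 ∧ G.degree q = 2)

theorem degree_of_leaf (h : G.IsMinCounterexample) (hv : G.Nbr1 v u) : G.degree u = 3 := by
  have h1 := h.one_le_degree u
  have h3 := h.degree_le u
  have huv : G.Adj u v := hv.adj.symm
  have hd : G.degree u = 1 ∨ G.degree u = 2 ∨ G.degree u = 3 := by omega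
  rcases hd with hd | hd | hd
  · have := h.single1 hv (nbr1_of_adj hd huv).outList
    simp [hd, degWeight] at this
  · obtain ⟨w, hu⟩ := exists_nbr2 hd huv
    have e1 := h.single1 hv hu.outList
    have hw1 := h.one_le_degree w
    simp [hd, degWeight] at e1
    have hw : G.degree w = 1 ∨ G.degree w = 2 := by omega
    rcases hw with hw | hw
    · have := h.single2 hu hv.outList (nbr1_of_adj hw hu.adj₂.symm).outList
      simp [hw, hv.degree, degWeight] at this
    · obtain ⟨z, hwz⟩ := exists_nbr2 hw hu.adj₂.symm
      have := h.single2 hu hv.outList hwz.outList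
      have := h.one_le_degree z
      simp [hw, hv.degree, degWeight] at *
      omega
  · exact hd

theorem two_le_degree_of_support (h : G.IsMinCounterexample) (hv : G.Nbr1 v u)
    (hu : G.Nbr3 u v a b) : 2 ≤ G.degree a := by
  by_contra ha
  have h1 := h.one_le_degree a
  have ha : G.degree a = 1 := by omega
  have hA := (nbr1_of_adj ha hu.adj₂.symm).outList
  have hb1 := h.one_le_degree b
  have hb3 := h.degree_le b
  have hd : G.degree b = 1 ∨ G.degree b = 2 ∨ G.degree b = 3 := by omega
  rcases hd with hd | hd | hd
  · have := h.single3 hu hv.outList hA (nbr1_of_adj hd hu.adj₃.symm).outList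
    simp [ha, hd, hv.degree, degWeight] at this
  · obtain ⟨z, hz⟩ := exists_nbr2 hd hu.adj₃.symm
    have := h.single3 hu hv.outList hA hz.outList
    have := h.one_le_degree z
    simp [ha, hd, hv.degree, degWeight] at *
    omega
  · obtain ⟨z, w, hz⟩ := exists_nbr3 hd hu.adj₃.symm
    have := h.single3 hu hv.outList hA hz.outList
    have := h.one_le_degree z
    have := h.one_le_degree w
    simp [ha, hd, hv.degree, degWeight] at *
    omega

theorem degree_add_degree (h : G.IsMinCounterexample) (hb : G.Nbr3 b u p q) :
    3 ≤ G.degree p + G.degree q := by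
  have h1 := h.one_le_degree p
  have h2 := h.one_le_degree q
  by_contra hlt
  have := h.two_le_degree_of_support (nbr1_of_adj (by omega) hb.adj₂.symm) hb.swap₁₂.swap₂₃
  omega

/-- If a has degree two, its outer neighbor is not a leaf, as a leaf's neighbor has degree three:
cost at most 3. If a has degree three, it does not see two leaves: cost at most 5 + 3. -/
theorem exists_outList_support (h : G.IsMinCounterexample) (hv : G.Nbr1 v u)
    (hu : G.Nbr3 u v a b) : ∃ A, G.OutList u a A ∧
      (A.map fun z => 7 - 2 * G.degree z).sum + 3 ≤ degWeight (G.degree a) + 6 ∧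
      (G.degree a = 2 → (A.map fun z => 7 - 2 * G.degree z).sum ≤ 3) ∧
      (G.degree a = 3 → (A.map fun z => 7 - 2 * G.degree z).sum ≤ 8) := by
  have h1 := h.two_le_degree_of_support hv hu
  have h3 := h.degree_le a
  have hd : G.degree a = 2 ∨ G.degree a = 3 := by omega
  rcases hd with hd | hd
  · obtain ⟨z, hz⟩ := exists_nbr2 hd hu.adj₂.symm
    refine ⟨_, hz.outList, ?_⟩
    have h4 := h.one_le_degree z
    have h5 : G.degree z ≠ 1 := fun h5 => by
      have := h.degree_of_leaf (nbr1_of_adj h5 hz.adj₂.symm)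
      omega
    simp [hd, degWeight]
    omega
  · obtain ⟨z, w, hz⟩ := exists_nbr3 hd hu.adj₂.symm
    refine ⟨_, hz.outList, ?_⟩
    have h4 := h.one_le_degree z
    have h5 := h.one_le_degree w
    have h6 := h.degree_add_degree hz
    simp [hd, degWeight]
    omega

/-- If a had degree two, N[u] would weigh 5 + 9 + 6 + 6 = 26 ≥ 14 + 3 + 3 or 5 + 9 + 6 + 5 = 25 = 14
+ 3 + 8, according to the degree of b. -/
theorem degree_of_support (h : G.IsMinCounterexample) (hv : G.Nbr1 v u)
    (hu : G.Nbr3 u v a b) : G.degree a = 3 := by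
  obtain ⟨A, hA, _, hA2, hA3⟩ := h.exists_outList_support hv hu
  obtain ⟨B, hB, _, hB2, hB3⟩ := h.exists_outList_support hv hu.swap₂₃
  have ha := h.two_le_degree_of_support hv hu
  have hb := h.two_le_degree_of_support hv hu.swap₂₃
  have ha3 := h.degree_le a
  have hb3 := h.degree_le b
  by_contra hne
  have ha : G.degree a = 2 := by omega
  have := h.single3 hu hv.outList hA hB
  have hd : G.degree b = 2 ∨ G.degree b = 3 := by omega
  rcases hd with hd | hd <;> simp [ha, hd, hv.degree, degWeight] at this hA2 hB2 hB3 <;> omega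

/-- A vertex of degree three has total hit cost at most six on two of its neighbors. -/
theorem cost_le_six (h : G.IsMinCounterexample) (hb : G.Nbr3 b u p q) :
    7 - 2 * G.degree p + (7 - 2 * G.degree q) ≤ 6 := by
  have h1 := h.one_le_degree p
  have h2 := h.one_le_degree q
  by_cases hp : G.degree p = 1
  · have := h.degree_of_support (nbr1_of_adj hp hb.adj₂.symm) hb.rotate.rotate
    omega
  by_cases hq : G.degree q = 1
  · have := h.degree_of_support (nbr1_of_adj hq hb.adj₃.symm) hb.rotate.swap₂₃
    omega
  omega

/-- Single costs are 5, 3 or 1, so a total that is at least 5 and at most 6 is 5 + 1 or 3 + 3. -/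
theorem heavy_of_cost (h : G.IsMinCounterexample) (hb : G.Nbr3 b u p q)
    (hc : 5 ≤ 7 - 2 * G.degree p + (7 - 2 * G.degree q)) : Heavy G u b := by
  have h0 := h.cost_le_six hb
  have h1 := h.one_le_degree p
  have h2 := h.one_le_degree q
  have h3 := h.degree_le p
  have h4 := h.degree_le q
  by_cases hp : G.degree p ≤ G.degree q
  · exact ⟨p, q, hb, by omega⟩
  · exact ⟨q, p, hb.swap₂₃, by omega⟩

/-- N[u] weighs 5 + 9 + 5 + 5 = 24, so the outer costs of a and b total more than 10, while that of
b is at most 6. -/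
theorem heavy_of_support (h : G.IsMinCounterexample) (hv : G.Nbr1 v u)
    (hu : G.Nbr3 u v a b) : Heavy G u a := by
  obtain ⟨p, q, ha⟩ := exists_nbr3 (h.degree_of_support hv hu) hu.adj₂.symm
  obtain ⟨r, s, hb⟩ := exists_nbr3 (h.degree_of_support hv hu.swap₂₃) hu.adj₃.symm
  have h1 := h.single3 hu hv.outList ha.outList hb.outList
  have h2 := h.cost_le_six hb
  refine h.heavy_of_cost ha ?_
  simp [ha.degree, hb.degree, hv.degree, degWeight] at h1
  omega

/-- A neighbor of a neighbor of a vertex of degree two is not a leaf. -/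
theorem two_le_degree_of_adj_adj (h : G.IsMinCounterexample) (hx : G.degree x = 2)
    (hxu : G.Adj x u) (huz : G.Adj u p) : 2 ≤ G.degree p := by
  have h1 := h.one_le_degree p
  by_contra hlt
  have hp := nbr1_of_adj (by omega) huz.symm
  have hu := h.degree_of_leaf hp
  by_cases hpx : p = x
  · subst hpx; omega
  obtain ⟨b, hb⟩ := exists_nbr3_of_adj hu huz hxu.symm hpx
  have := h.degree_of_support hp hb
  omega

theorem two_le_degree_of_adj (h : G.IsMinCounterexample) (hx : G.degree x = 2)
    (hxu : G.Adj x u) : 2 ≤ G.degree u := by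
  have h1 := h.one_le_degree u
  by_contra hlt
  have := h.degree_of_leaf (nbr1_of_adj (by omega) hxu.symm)
  omega

end IsMinCounterexample

/-! ### Vertices of degree two: consecutive ones, and the ends of adjacent pairs. -/

namespace IsMinCounterexample

variable {V : Type*} [Fintype V] [DecidableEq V] {G : SimpleGraph V} [DecidableRel G.Adj]
  {u v a b c p q r s t x y : V}

/-- N[v] weighs 18, so the two outer hits must cost more than 4, although each costs at most 3. A
triangle would have no outer hits at all. -/
theorem degree_of_path_middle (h : G.IsMinCounterexample) {a' b' : V} (hv : G.Nbr2 v a b)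
    (ha : G.Nbr2 a v a') (hb : G.Nbr2 b v b') :
    ¬ G.Adj a b ∧ G.degree a' = 2 ∧ G.degree b' = 2 := by
  have hab : ¬ G.Adj a b := by
    intro hab
    have := h.single2 hv (A := []) (B := []) (ha.outList_of_adj hab hv.adj₂) (hb.outList_of_adj hab.symm hv.adj₁)
    simp [ha.degree, hb.degree, degWeight] at this
  have h1 := h.two_le_degree_of_adj ha.degree ha.adj₂
  have h2 := h.two_le_degree_of_adj hb.degree hb.adj₂
  have h3 := h.degree_le a'
  have h4 := h.degree_le b'
  have := h.single2 hv ha.outList hb.outList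
  simp [ha.degree, hb.degree, degWeight] at this
  exact ⟨hab, by omega, by omega⟩

/-- By `degree_of_path_middle`, degree two propagates along the path. Either it closes to a
component C5, of weight 30 ≥ 28, or six consecutive vertices are dominated by two; the latter weigh
36 = 28 + 8, enough even if both ends see the same vertex (3 + 5). -/
theorem not_three_consecutive (h : G.IsMinCounterexample) (hv : G.Nbr2 v a b)
    (ha : G.degree a = 2) (hb : G.degree b = 2) : False := by
  obtain ⟨x0, n1⟩ := exists_nbr2 ha hv.adj₁.symm
  obtain ⟨x4, n3⟩ := exists_nbr2 hb hv.adj₂.symm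
  obtain ⟨h13, h0, h4⟩ := h.degree_of_path_middle hv n1 n3
  obtain ⟨y, n0⟩ := exists_nbr2 h0 n1.adj₂.symm
  obtain ⟨x5, n4⟩ := exists_nbr2 h4 n3.adj₂.symm
  obtain ⟨h02, hy, -⟩ := h.degree_of_path_middle n1.symm n0 hv
  obtain ⟨h24, -, h5⟩ := h.degree_of_path_middle n3 hv.symm n4
  obtain ⟨z, n5⟩ := exists_nbr2 h5 n4.adj₂.symm
  obtain ⟨h35, -, hz⟩ := h.degree_of_path_middle n4 n3.symm n5
  have d2 := hv.degree
  have c4 := h.c4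
  have irr := G.loopless.irrefl
  have sym := fun a b (h : G.Adj a b) => h.symm
  have a0 := n0.adj₁; have a1 := n1.adj₁; have a3 := n3.adj₁; have a4 := n4.adj₁
  have b1 := n1.adj₂; have b3 := n3.adj₂; have b4 := n4.adj₂; have a5 := n5.adj₁
  obtain ⟨e0, i0⟩ := n0
  obtain ⟨e1, i1⟩ := n1
  obtain ⟨e2, i2⟩ := hv
  obtain ⟨e3, i3⟩ := n3
  obtain ⟨e4, i4⟩ := n4
  obtain ⟨e5, i5⟩ := n5
  have hnd : [x0, a, v, b, x4].Nodup := by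
    simp only [List.nodup_cons, List.mem_cons, not_or, List.not_mem_nil, not_false_eq_true,
      List.nodup_nil, and_true]
    repeat' apply And.intro
    all_goals grind
  by_cases h05 : x5 = x0
  · simp only [List.nodup_cons, List.mem_cons, not_or] at hnd
    refine h.reduce [a, b] [x0, a, v, b, x4] [] (by simp) ?_ (by simp) ?_ ?_ ?_ ?_ ?_
    · simp [hnd]
    · simp [i1, i3]; grind
    · simp [i1, i3]
    · simp [i0, i1, i2, i3, i4, h05]
    · have hy4 : x4 = a ∨ x4 = y := (i0 x4).1 (sym _ _ (h05 ▸ b4))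
      have hy4 : y = x4 := by grind
      simp [i0, i1, i2, i3, i4, h05, hy4]
    · simp [hitCost, degWeight, *]
  · have hnd : [x0, a, v, b, x4, x5].Nodup := by
      simp only [List.nodup_cons, List.mem_cons, not_or, List.not_mem_nil, not_false_eq_true,
        List.nodup_nil, and_true]
      repeat' apply And.intro
      all_goals grind
    refine h.reduce [a, x4] [x0, a, v, b, x4, x5] [(x0, y), (x5, z)] (by simp) hnd (by simp)
      ?_ ?_ ?_ ?_ ?_
    · simp [i1, i4]; grind
    · simp [i1, i4]
    · simp [i0, i1, i2, i3, i4, i5]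
    · simp [i0, i1, i2, i3, i4, i5]
    · simp [hitCost, degWeight, List.count_cons, *]
      split_ifs <;> simp

theorem not_all_degree_two (h : G.IsMinCounterexample) (hv : G.Nbr3 v a b c)
    (ha : G.degree a = 2) (hb : G.degree b = 2) (hc : G.degree c = 2) : False := by
  obtain ⟨a', na⟩ := exists_nbr2 ha hv.adj₁.symm
  obtain ⟨b', nb⟩ := exists_nbr2 hb hv.adj₂.symm
  obtain ⟨c', nc⟩ := exists_nbr2 hc hv.adj₃.symm
  have h1 := h.two_le_degree_of_adj ha na.adj₂
  have h2 := h.two_le_degree_of_adj hb nb.adj₂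
  have h3 := h.two_le_degree_of_adj hc nc.adj₂
  have := h.single3 hv na.outList nb.outList nc.outList
  simp [ha, hb, hc, degWeight] at this
  omega

theorem degree_three_of_two (h : G.IsMinCounterexample) (hv : G.Nbr3 v s t q)
    (hs : G.degree s = 2) (ht : G.degree t = 2) : G.degree q = 3 := by
  have h1 := h.two_le_degree_of_adj_adj hs hv.adj₁.symm hv.adj₃
  have h2 := h.degree_le q
  by_contra h3
  exact h.not_all_degree_two hv hs ht (by omega)

/-- If a vertex of degree three has two neighbors of degree two, then one of these has another
neighbor of degree two. -/
theorem degree_two_or (h : G.IsMinCounterexample) {s' t' : V} (hv : G.Nbr3 v s t q)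
    (hs : G.Nbr2 s v s') (ht : G.Nbr2 t v t') : G.degree s' = 2 ∨ G.degree t' = 2 := by
  have hq := h.degree_three_of_two hv hs.degree ht.degree
  obtain ⟨q1, q2, nq⟩ := exists_nbr3 hq hv.adj₃.symm
  have h1 := h.two_le_degree_of_adj hs.degree hs.adj₂
  have h2 := h.two_le_degree_of_adj ht.degree ht.adj₂
  have h3 := h.cost_le_six nq
  have := h.single3 hv hs.outList ht.outList nq.outList
  simp [hs.degree, ht.degree, hq, degWeight] at this
  omega

/-- The surroundings of one end of a pair `x, x'` of adjacent vertices of degree two. -/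
structure PairEnd (G : SimpleGraph V) [DecidableRel G.Adj] (x x' y p p' q : V) : Prop where
  nbr_x : G.Nbr2 x x' y
  degree_x' : G.degree x' = 2
  nbr_y : G.Nbr3 y x p q
  nbr_p : G.Nbr2 p y p'
  degree_q : G.degree q = 3
  not_adj : ¬ G.Adj p q
  degree_p' : G.degree p' = 2 ∨ G.degree p' = 3 ∧ Heavy G y q

/-- Removing N[x], of weight 17, forces a neighbor p of degree two at y. Removing N[y], of weight
22, then excludes the edge pq (the hits would cost at most 3 + 5), and makes q heavy when p' has
degree three. -/
theorem exists_pairEnd (h : G.IsMinCounterexample) {x' y' : V} (hx : G.Nbr2 x x' y)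
    (hx' : G.Nbr2 x' x y') : ∃ p p' q, PairEnd G x x' y p p' q := by
  have hd : ∀ {a b c}, G.Nbr2 a b c → G.degree b = 2 → G.degree c = 3 := by
    intro a b c hn hb
    have h1 := h.two_le_degree_of_adj hn.degree hn.adj₂
    have h2 := h.degree_le c
    by_contra h3
    exact h.not_three_consecutive hn hb (by omega)
  have hy := hd hx hx'.degree
  have hy' := hd hx' hx.degree
  have key : ∃ p q, G.Nbr3 y x p q ∧ G.degree p = 2 := by
    obtain ⟨p, q, hn⟩ := exists_nbr3 hy hx.adj₂.symm
    have h1 := h.two_le_degree_of_adj_adj hx.degree hx.adj₂ hn.adj₂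
    have h2 := h.two_le_degree_of_adj_adj hx.degree hx.adj₂ hn.adj₃
    have h3 := h.single2 hx hx'.outList hn.outList
    simp [hx'.degree, hy, hy', degWeight] at h3
    by_cases hp : G.degree p = 2
    · exact ⟨p, q, hn, hp⟩
    · exact ⟨q, p, hn.swap₂₃, by omega⟩
  obtain ⟨p, q, hn, hp⟩ := key
  have hq := h.degree_three_of_two hn hx.degree hp
  obtain ⟨p', np⟩ := exists_nbr2 hp hn.adj₂.symm
  obtain ⟨q1, q2, nq⟩ := exists_nbr3 hq hn.adj₃.symm
  refine ⟨p, p', q, hx, hx'.degree, hn, np, hq, fun hpq => ?_, ?_⟩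
  · obtain ⟨q3, nq⟩ := exists_nbr3_of_adj hq hn.adj₃.symm hpq.symm hn.adj₂.ne
    have h1 := h.one_le_degree q3
    have := h.single3 hn hx.symm.outList (np.outList_of_adj hpq hn.adj₃)
      (nq.outList_triangle hn.adj₂)
    simp [hx.degree, hx'.degree, hp, hq, degWeight] at this
    omega
  · have h1 := h.two_le_degree_of_adj hp np.adj₂
    have h2 := h.degree_le p'
    by_cases hp' : G.degree p' = 2
    · exact .inl hp'
    · refine .inr ⟨by omega, h.heavy_of_cost nq ?_⟩
      have := h.single3 hn hx.symm.outList np.outList nq.outList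
      have : G.degree p' = 3 := by omega
      simp [hx.degree, hx'.degree, hp, hq, degWeight, this] at *
      omega

theorem exists_pairEnds (h : G.IsMinCounterexample) {x' : V} (hx : G.degree x = 2)
    (hx' : G.degree x' = 2) (hadj : G.Adj x x') : ∃ y p p' q y' P P' Q,
      PairEnd G x x' y p p' q ∧ PairEnd G x' x y' P P' Q ∧ y ≠ y' := by
  obtain ⟨y, nx⟩ := exists_nbr2 hx hadj
  obtain ⟨y', nx'⟩ := exists_nbr2 hx' hadj.symm
  obtain ⟨p, p', q, h1⟩ := h.exists_pairEnd nx nx'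
  obtain ⟨P, P', Q, h2⟩ := h.exists_pairEnd nx' nx
  refine ⟨y, p, p', q, y', P, P', Q, h1, h2, ?_⟩
  rintro rfl
  have := h.single2 nx (nx'.outList_of_adj nx'.adj₂ nx.adj₂)
    (Nbr3.outList_triangle (p := x')
      ((exists_nbr3_of_adj h1.nbr_y.degree nx.adj₂.symm nx'.adj₂.symm hadj.ne).choose_spec)
      hadj)
  simp [hx', h1.nbr_y.degree, degWeight] at this
  have h5 := h.two_le_degree_of_adj_adj hx nx.adj₂ ((exists_nbr3_of_adj h1.nbr_y.degree
    nx.adj₂.symm nx'.adj₂.symm hadj.ne).choose_spec).adj₃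
  omega

end IsMinCounterexample

/-! ### Comparing the two ends of a pair. -/

namespace IsMinCounterexample

variable {V : Type*} [Fintype V] [DecidableEq V] {G : SimpleGraph V} [DecidableRel G.Adj]
  {u v a b c p q r s t x y x' y' p' P P' Q : V}

theorem PairEnd.degree_p'_ne (h : G.IsMinCounterexample) (h1 : PairEnd G x x' y p p' q)
    (h2 : PairEnd G x' x y' P P' Q) (hp : p ≠ P) (hpp : p' = P') : G.degree p' = 3 := by
  subst hpp
  rcases h1.degree_p' with h3 | h3
  · obtain ⟨b, hb⟩ := exists_nbr2 h3 h1.nbr_p.adj₂.symm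
    have : P = b := by
      rcases (hb.adj_iff P).1 h2.nbr_p.adj₂.symm with h4 | h4
      · exact absurd h4.symm hp
      · exact h4
    subst this
    exact (h.not_three_consecutive hb h1.nbr_p.degree h2.nbr_p.degree).elim
  · exact h3.1

/-- If q = Q, then N[y] ∪ N[y'] has only seven vertices, of weight 39 = 28 + 11. The hits on p', P'
and the third neighbor of q cost at most 3 + 3 + 5; if p' = P', that vertex has degree three and
costs 1 + 3 in total. -/
theorem PairEnd.q_ne (h : G.IsMinCounterexample) (h1 : PairEnd G x x' y p p' q)
    (h2 : PairEnd G x' x y' P P' Q) (hyy : y ≠ y') : q ≠ Q := by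
  rintro rfl
  obtain ⟨r, nq⟩ := exists_nbr3_of_adj h1.degree_q h1.nbr_y.adj₃.symm h2.nbr_y.adj₃.symm hyy
  have c4 := h.c4
  have irr := G.loopless.irrefl
  have sym := fun a b (h : G.Adj a b) => h.symm
  have dx := h1.nbr_x.degree
  have dx' := h2.nbr_x.degree
  have dy := h1.nbr_y.degree
  have dy' := h2.nbr_y.degree
  have dp := h1.nbr_p.degree
  have dP := h2.nbr_p.degree
  have dq := h1.degree_q
  have dp' : 2 ≤ G.degree p' := by rcases h1.degree_p' with h | h <;> omega
  have dP' : 2 ≤ G.degree P' := by rcases h2.degree_p' with h | h <;> omega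
  have dr := h.one_le_degree r
  have hpp := PairEnd.degree_p'_ne h h1 h2
  obtain ⟨ex, ix⟩ := h1.nbr_x
  obtain ⟨ex', ix'⟩ := h2.nbr_x
  obtain ⟨ep, ip⟩ := h1.nbr_p
  obtain ⟨eP, iP⟩ := h2.nbr_p
  obtain ⟨ey1, ey2, ey3, iy⟩ := h1.nbr_y
  obtain ⟨ey1', ey2', ey3', iy'⟩ := h2.nbr_y
  obtain ⟨eq1, eq2, eq3, iq⟩ := nq
  have a1 := h1.nbr_x.adj₁
  have a2 := h1.nbr_y.adj₁
  have a3 := h1.nbr_y.adj₂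
  have a4 := h1.nbr_y.adj₃
  have a5 := h2.nbr_y.adj₁
  have a6 := h2.nbr_y.adj₂
  have a7 := h2.nbr_y.adj₃
  have a8 := h1.nbr_p.adj₂
  have a9 := h2.nbr_p.adj₂
  have a10 := (iq r).2 (by simp)
  have hpP : p ≠ P := by grind
  have hnd : [y, x, p, q, y', x', P].Nodup := by
    simp only [List.nodup_cons, List.mem_cons, not_or, List.not_mem_nil, not_false_eq_true,
      List.nodup_nil, and_true]
    repeat' apply And.intro
    all_goals grind
  have e1 : r ≠ p' := by grind
  have e2 : r ≠ P' := by grind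
  refine h.reduce [y, y'] [y, x, p, q, y', x', P] [(p, p'), (P, P'), (q, r)] (by simp) hnd
    (by simp) ?_ ?_ ?_ ?_ ?_
  · simp [iy, iy']; grind
  · simp [iy, iy']
  · simp [ix, ix', ip, iP, iq]
  · simp [ix, ix', ip, iP, iq, iy, iy']
  · have := hpp hpP
    simp [hitCost, degWeight, List.count_cons, dx, dx', dy, dy', dp, dP, dq, e1, e2]
    split_ifs with h3
    · have := hpp hpP h3.symm
      have : G.degree P' = 3 := h3 ▸ this
      omega
    · omega

end IsMinCounterexample

/-! ### Excluding a seven-cycle that contains two pairs. -/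

namespace IsMinCounterexample

variable {V : Type*} [Fintype V] [DecidableEq V] {G : SimpleGraph V} [DecidableRel G.Adj]
  {u v a b c p q r s t x y z x' y' p' P P' Q R : V}

/-- A seven-cycle `y x x' y' z p' p` with `y'` adjacent to `z`: the case that the outer neighbor
of `P` has degree two. -/
theorem sevenCycle_degree_two (h : G.IsMinCounterexample) (nx : G.Nbr2 x x' y) (nx' : G.Nbr2 x' x y') (ny : G.Nbr3 y x p q) (np : G.Nbr2 p y p')
    (np' : G.Nbr2 p' p z) (nz : G.Nbr3 z p' R y') (ny' : G.Nbr3 y' x' P z) (nP : G.Nbr2 P y' P')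
    (dq : G.degree q = 3) (dR : G.degree R = 2) (hPz : ¬ G.Adj P z)
    (hyy : y ≠ y')
    (dP' : G.degree P' = 2) : False := by
  obtain ⟨P₂, nP'⟩ := exists_nbr2 dP' nP.adj₂.symm
  have dP₂ := h.two_le_degree_of_adj nP'.degree nP'.adj₂
  have hP₂ := h.not_three_consecutive nP' nP.degree
  have c4 := h.c4
  have irr := G.loopless.irrefl
  have sym := fun a b (h : G.Adj a b) => h.symm
  have dx := nx.degree
  have dx' := nx'.degree
  have dy := ny.degree
  have dy' := ny'.degree
  have dp := np.degree
  have dp' := np'.degree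
  have dP := nP.degree
  have dz := nz.degree
  obtain ⟨ex, ix⟩ := nx
  obtain ⟨ex', ix'⟩ := nx'
  obtain ⟨ep, ip⟩ := np
  obtain ⟨ep', ip'⟩ := np'
  obtain ⟨eP, iP⟩ := nP
  obtain ⟨ey1, ey2, ey3, iy⟩ := ny
  obtain ⟨ey1', ey2', ey3', iy'⟩ := ny'
  obtain ⟨ez1, ez2, ez3, iz⟩ := nz
  have a1 := (ix x').2 (by simp)
  have a2 := (iy x).2 (by simp)
  have a3 := (iy p).2 (by simp)
  have a4 := (iy q).2 (by simp)
  have a5 := (iy' x').2 (by simp)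
  have a6 := (iy' P).2 (by simp)
  have a7 := (iy' z).2 (by simp)
  have a8 := (ip p').2 (by simp)
  have a9 := (iP P').2 (by simp)
  have a10 := (iz p').2 (by simp)
  have a11 := (iz R).2 (by simp)
  obtain ⟨eP', iP'⟩ := nP'
  have hxP : x' ≠ P' := by
    rintro rfl
    have h1 := (ix' P).1 a9.symm
    have h2 := iP y
    grind
  have hnd : [y, x, x', p, p', z, y', P, P'].Nodup := by
    simp only [List.nodup_cons, List.mem_cons, not_or, List.not_mem_nil, not_false_eq_true,
      List.nodup_nil, and_true]
    repeat' apply And.intro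
    all_goals grind
  refine h.reduce [x, p', P] [y, x, x', p, p', z, y', P, P'] [(y, q), (z, R), (P', P₂)] (by simp)
    hnd (by simp) ?_ ?_ ?_ ?_ ?_
  · simp [ix, ip', iP]; grind
  · simp [ix, ip', iP]
  · simp [ix, ix', ip, ip', iP, iP', iy, iy', iz]
  · simp [ix, ix', ip, ip', iP, iP', iy, iy', iz]
  -- The third neighbor P₂ has degree three, so among the hits q, R, P₂ only q = P₂ is possible: at
  -- most 3 + 1 + 3 against 51 - 42.
  · have e1 : R ≠ q := by rintro rfl; omega
    have e2 : P₂ ≠ R := by rintro rfl; exact hP₂ dR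
    simp [hitCost, degWeight, List.count_cons, dx, dx', dy, dy', dp, dP, dq, dR, dP', dz, dp', e1,
      e2]
    split_ifs <;> omega

/-- Now q itself lies in U, so only R and the third neighbor of q are hit: at most 3 + 5 = 50 - 42,
also if they coincide. -/
theorem sevenCycle_eq (h : G.IsMinCounterexample) (nx : G.Nbr2 x x' y) (nx' : G.Nbr2 x' x y') (ny : G.Nbr3 y x p q) (np : G.Nbr2 p y p')
    (np' : G.Nbr2 p' p z) (nz : G.Nbr3 z p' R y') (ny' : G.Nbr3 y' x' P z) (nP : G.Nbr2 P y' P')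
    (dq : G.degree q = 3) (dR : G.degree R = 2) (hPz : ¬ G.Adj P z)
    (hyy : y ≠ y')
    (hq : q = P') : False := by
  subst hq
  have hPy : P ≠ y := by have := nP.degree; have := ny.degree; rintro rfl; omega
  obtain ⟨s, nq⟩ := exists_nbr3_of_adj dq ny.adj₃.symm nP.adj₂.symm hPy.symm
  have ds := h.one_le_degree s
  have c4 := h.c4
  have irr := G.loopless.irrefl
  have sym := fun a b (h : G.Adj a b) => h.symm
  have dx := nx.degree
  have dx' := nx'.degree
  have dy := ny.degree
  have dy' := ny'.degree
  have dp := np.degree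
  have dp' := np'.degree
  have dP := nP.degree
  have dz := nz.degree
  obtain ⟨ex, ix⟩ := nx
  obtain ⟨ex', ix'⟩ := nx'
  obtain ⟨ep, ip⟩ := np
  obtain ⟨ep', ip'⟩ := np'
  obtain ⟨eP, iP⟩ := nP
  obtain ⟨ey1, ey2, ey3, iy⟩ := ny
  obtain ⟨ey1', ey2', ey3', iy'⟩ := ny'
  obtain ⟨ez1, ez2, ez3, iz⟩ := nz
  have a1 := (ix x').2 (by simp)
  have a2 := (iy x).2 (by simp)
  have a3 := (iy p).2 (by simp)
  have a4 := (iy q).2 (by simp)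
  have a5 := (iy' x').2 (by simp)
  have a6 := (iy' P).2 (by simp)
  have a7 := (iy' z).2 (by simp)
  have a8 := (ip p').2 (by simp)
  have a9 := (iP q).2 (by simp)
  have a10 := (iz p').2 (by simp)
  have a11 := (iz R).2 (by simp)
  obtain ⟨eq1, eq2, eq3, iq⟩ := nq
  have hnd : [y, x, x', p, p', z, y', P, q].Nodup := by
    simp only [List.nodup_cons, List.mem_cons, not_or, List.not_mem_nil, not_false_eq_true,
      List.nodup_nil, and_true]
    repeat' apply And.intro
    all_goals grind
  refine h.reduce [x, p', P] [y, x, x', p, p', z, y', P, q] [(z, R), (q, s)] (by simp)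
    hnd (by simp) ?_ ?_ ?_ ?_ ?_
  · simp [ix, ip', iP]; grind
  · simp [ix, ip', iP]
  · simp [ix, ix', ip, ip', iP, iq, iy, iy', iz]
  · simp [ix, ix', ip, ip', iP, iq, iy, iy', iz]
  · simp [hitCost, degWeight, List.count_cons, dx, dx', dy, dy', dp, dP, dq, dR, dz, dp']
    split_ifs with h3
    · subst h3; omega
    · omega

/-- Here q is hit twice by U. If s has degree three, the cost is 1 + 3 + 3 + 1 = 8 = 50 - 42. If s
has degree two, removing N[P'] shows that the third neighbor l of q is a leaf; adding l to S and l,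
q to U gives weight 64 = 56 + 8, enough even if R = s. -/
theorem sevenCycle_adj (h : G.IsMinCounterexample) (nx : G.Nbr2 x x' y) (nx' : G.Nbr2 x' x y') (ny : G.Nbr3 y x p q) (np : G.Nbr2 p y p')
    (np' : G.Nbr2 p' p z) (nz : G.Nbr3 z p' R y') (ny' : G.Nbr3 y' x' P z) (nP : G.Nbr2 P y' P')
    (dq : G.degree q = 3) (dR : G.degree R = 2) (hPz : ¬ G.Adj P z)
    (hyy : y ≠ y')
    (nP' : G.Nbr3 P' P q s) (hq : P' ≠ q) : False := by
  have dP' := nP'.degree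
  have hyP' : y ≠ P' := by
    rintro rfl
    have := ny.degree
    rcases (ny.adj_iff P).1 nP.adj₂.symm with rfl | rfl | rfl
    · have := (nx.adj_iff y').1 nP.adj₁
      exact hyy (this.resolve_left ny'.adj₁.ne).symm
    · have := (np.adj_iff y').1 nP.adj₁
      rcases this with h1 | h1
      · exact hyy h1.symm
      · have := ny'.degree
        have := np'.degree
        rw [h1] at *
        omega
    · have := nP.degree
      omega
  obtain ⟨l, nq⟩ := exists_nbr3_of_adj dq ny.adj₃.symm nP'.adj₂.symm hyP'
  have ds := h.two_le_degree_of_adj_adj nP.degree nP.adj₂ nP'.adj₃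
  have ds3 := h.degree_le s
  have dl := h.one_le_degree l
  have hl : G.degree s = 2 → G.degree l = 1 := by
    intro ds
    obtain ⟨s', ns⟩ := exists_nbr2 ds nP'.adj₃.symm
    have h1 := h.two_le_degree_of_adj ds ns.adj₂
    have := h.single3 nP' nP.symm.outList nq.swap₁₂.outList ns.outList
    have := nq.degree
    have := ny.degree
    have := ny'.degree
    simp [nP.degree, degWeight, *] at *
    omega
  have c4 := h.c4
  have irr := G.loopless.irrefl
  have sym := fun a b (h : G.Adj a b) => h.symm
  have dx := nx.degree
  have dx' := nx'.degree
  have dy := ny.degree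
  have dy' := ny'.degree
  have dp := np.degree
  have dp' := np'.degree
  have dP := nP.degree
  have dz := nz.degree
  obtain ⟨ex, ix⟩ := nx
  obtain ⟨ex', ix'⟩ := nx'
  obtain ⟨ep, ip⟩ := np
  obtain ⟨ep', ip'⟩ := np'
  obtain ⟨eP, iP⟩ := nP
  obtain ⟨ey1, ey2, ey3, iy⟩ := ny
  obtain ⟨ey1', ey2', ey3', iy'⟩ := ny'
  obtain ⟨ez1, ez2, ez3, iz⟩ := nz
  have a1 := (ix x').2 (by simp)
  have a2 := (iy x).2 (by simp)
  have a3 := (iy p).2 (by simp)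
  have a4 := (iy q).2 (by simp)
  have a5 := (iy' x').2 (by simp)
  have a6 := (iy' P).2 (by simp)
  have a7 := (iy' z).2 (by simp)
  have a8 := (ip p').2 (by simp)
  have a9 := (iP P').2 (by simp)
  have a10 := (iz p').2 (by simp)
  have a11 := (iz R).2 (by simp)
  obtain ⟨eq1, eq2, eq3, iq⟩ := nq
  obtain ⟨eP1, eP2, eP3, iP'⟩ := nP'
  have hnd : [y, x, x', p, p', z, y', P, P'].Nodup := by
    simp only [List.nodup_cons, List.mem_cons, not_or, List.not_mem_nil, not_false_eq_true,
      List.nodup_nil, and_true]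
    repeat' apply And.intro
    all_goals grind
  have e1 : R ≠ q := by rintro rfl; omega
  have e2 : q ≠ s := eP3
  by_cases ds2 : G.degree s = 2
  · have dl := hl ds2
    have il : ∀ w, G.Adj l w ↔ w = q := (nbr1_of_adj dl ((iq l).2 (by simp)).symm).adj_iff
    have a12 := (iP' q).2 (by simp)
    have hq' : q ∉ [y, x, x', p, p', z, y', P, P'] := by
      simp only [List.mem_cons, not_or, List.not_mem_nil, not_false_eq_true, and_true]
      repeat' apply And.intro
      all_goals grind
    have hl' : l ∉ [q, y, x, x', p, p', z, y', P, P'] := by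
      simp only [List.mem_cons, not_or, List.not_mem_nil, not_false_eq_true, and_true]
      repeat' apply And.intro
      all_goals (rintro rfl; omega)
    refine h.reduce [x, p', P, l] [l, q, y, x, x', p, p', z, y', P, P'] [(z, R), (P', s)] (by simp)
      (List.nodup_cons.2 ⟨hl', List.nodup_cons.2 ⟨hq', hnd⟩⟩) (by simp) ?_ ?_ ?_ ?_ ?_
    · simp [ix, ip', iP, il]; grind
    · simp [ix, ip', iP, il]
    · simp [ix, ix', ip, ip', iP, iP', iq, iy, iy', iz, il]
    · simp [ix, ix', ip, ip', iP, iP', iq, iy, iy', iz, il]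
    · simp [hitCost, degWeight, List.count_cons, dx, dx', dy, dy', dp, dP, dq, dR, dz, dp', dP',
        dl, ds2]
      split_ifs <;> omega
  · have ds3 : G.degree s = 3 := by omega
    have e3 : R ≠ s := by rintro rfl; omega
    refine h.reduce [x, p', P] [y, x, x', p, p', z, y', P, P']
      [(y, q), (z, R), (P', q), (P', s)] (by simp) hnd (by simp) ?_ ?_ ?_ ?_ ?_
    · simp [ix, ip', iP]; grind
    · simp [ix, ip', iP]
    · simp [ix, ix', ip, ip', iP, iP', iy, iy', iz]
    · simp [ix, ix', ip, ip', iP, iP', iy, iy', iz]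
    · simp [hitCost, degWeight, dx, dx', dy, dy', dp, dP, dq, dR, dz, dp', dP',
        ds3, e1, e2, e3, e1.symm, e2.symm, e3.symm]

/-- The hits q, R, r, s are distinct and cost at most 1 + 3 + 4 = 50 - 42, as r and s are not both
of degree two. If P' were adjacent to R, its neighbors P and R of degree two would lead on to y' and
z, both of degree three, against `degree_two_or`. -/
theorem sevenCycle_not_adj (h : G.IsMinCounterexample) (nx : G.Nbr2 x x' y) (nx' : G.Nbr2 x' x y') (ny : G.Nbr3 y x p q) (np : G.Nbr2 p y p')
    (np' : G.Nbr2 p' p z) (nz : G.Nbr3 z p' R y') (ny' : G.Nbr3 y' x' P z) (nP : G.Nbr2 P y' P')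
    (dq : G.degree q = 3) (dR : G.degree R = 2) (hPz : ¬ G.Adj P z)
    (hyy : y ≠ y')
    (nP' : G.Nbr3 P' P r s) (hr : r ≠ q) (hs : s ≠ q) (hq : P' ≠ q) : False := by
  have dP' := nP'.degree
  have dr := h.two_le_degree_of_adj_adj nP.degree nP.adj₂ nP'.adj₂
  have ds := h.two_le_degree_of_adj_adj nP.degree nP.adj₂ nP'.adj₃
  have hrs : ¬ (G.degree r = 2 ∧ G.degree s = 2) := fun h1 =>
    h.not_all_degree_two nP' nP.degree h1.1 h1.2
  have hR : ∀ t, G.Nbr3 P' P R t → False := by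
    intro t nt
    have hz : z ≠ P' := by
      rintro rfl
      exact hPz nP.adj₂
    have nR : G.Nbr2 R P' z := by
      obtain ⟨w, hw⟩ := exists_nbr2 dR nt.adj₂.symm
      have := (hw.adj_iff z).1 nz.adj₂.symm
      rcases this with h1 | h1
      · exact absurd h1 hz
      · rwa [h1]
    have := h.degree_two_or nt nP.symm nR
    have := ny'.degree
    have := nz.degree
    omega
  have e4 : R ≠ r := by rintro rfl; exact hR _ nP'
  have e5 : R ≠ s := by rintro rfl; exact hR _ nP'.swap₂₃
  have c4 := h.c4
  have irr := G.loopless.irrefl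
  have sym := fun a b (h : G.Adj a b) => h.symm
  have dx := nx.degree
  have dx' := nx'.degree
  have dy := ny.degree
  have dy' := ny'.degree
  have dp := np.degree
  have dp' := np'.degree
  have dP := nP.degree
  have dz := nz.degree
  obtain ⟨ex, ix⟩ := nx
  obtain ⟨ex', ix'⟩ := nx'
  obtain ⟨ep, ip⟩ := np
  obtain ⟨ep', ip'⟩ := np'
  obtain ⟨eP, iP⟩ := nP
  obtain ⟨ey1, ey2, ey3, iy⟩ := ny
  obtain ⟨ey1', ey2', ey3', iy'⟩ := ny'
  obtain ⟨ez1, ez2, ez3, iz⟩ := nz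
  have a1 := (ix x').2 (by simp)
  have a2 := (iy x).2 (by simp)
  have a3 := (iy p).2 (by simp)
  have a4 := (iy q).2 (by simp)
  have a5 := (iy' x').2 (by simp)
  have a6 := (iy' P).2 (by simp)
  have a7 := (iy' z).2 (by simp)
  have a8 := (ip p').2 (by simp)
  have a9 := (iP P').2 (by simp)
  have a10 := (iz p').2 (by simp)
  have a11 := (iz R).2 (by simp)
  obtain ⟨eP1, eP2, eP3, iP'⟩ := nP'
  have hnd : [y, x, x', p, p', z, y', P, P'].Nodup := by
    simp only [List.nodup_cons, List.mem_cons, not_or, List.not_mem_nil, not_false_eq_true,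
      List.nodup_nil, and_true]
    repeat' apply And.intro
    all_goals grind
  have e1 : R ≠ q := by rintro rfl; omega
  refine h.reduce [x, p', P] [y, x, x', p, p', z, y', P, P']
    [(y, q), (z, R), (P', r), (P', s)] (by simp) hnd (by simp) ?_ ?_ ?_ ?_ ?_
  · simp [ix, ip', iP]; grind
  · simp [ix, ip', iP]
  · simp [ix, ix', ip, ip', iP, iP', iy, iy', iz]
  · simp [ix, ix', ip, ip', iP, iP', iy, iy', iz]
  · simp [hitCost, degWeight, dx, dx', dy, dy', dp, dP, dq, dR, dz, dp', dP',
      e1, hr, hs, e4.symm, e5.symm, eP3.symm]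
    omega

theorem sevenCycle (h : G.IsMinCounterexample) (nx : G.Nbr2 x x' y) (nx' : G.Nbr2 x' x y') (ny : G.Nbr3 y x p q) (np : G.Nbr2 p y p')
    (np' : G.Nbr2 p' p z) (nz : G.Nbr3 z p' R y') (ny' : G.Nbr3 y' x' P z) (nP : G.Nbr2 P y' P')
    (dq : G.degree q = 3) (dR : G.degree R = 2) (hPz : ¬ G.Adj P z)
    (hyy : y ≠ y') : False := by
  have h1 := h.two_le_degree_of_adj nP.degree nP.adj₂
  have h2 := h.degree_le P'
  by_cases hq : P' = q
  · exact h.sevenCycle_eq nx nx' ny np np' nz ny' nP dq dR hPz hyy hq.symm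
  by_cases hd : G.degree P' = 2
  · exact h.sevenCycle_degree_two nx nx' ny np np' nz ny' nP dq dR hPz hyy hd
  have hd : G.degree P' = 3 := by omega
  by_cases hadj : G.Adj P' q
  · have hPq : P ≠ q := by rintro rfl; have := nP.degree; omega
    obtain ⟨s, nP'⟩ := exists_nbr3_of_adj hd nP.adj₂.symm hadj hPq
    exact h.sevenCycle_adj nx nx' ny np np' nz ny' nP dq dR hPz hyy nP' hq
  · obtain ⟨r, s, nP'⟩ := exists_nbr3 hd nP.adj₂.symm
    refine h.sevenCycle_not_adj nx nx' ny np np' nz ny' nP dq dR hPz hyy nP' ?_ ?_ hq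
    · rintro rfl; exact hadj nP'.adj₂
    · rintro rfl; exact hadj nP'.adj₃

end IsMinCounterexample

/-! ### Adjacent vertices of degree two lie in a five-cycle. -/

namespace IsMinCounterexample

variable {V : Type*} [Fintype V] [DecidableEq V] {G : SimpleGraph V} [DecidableRel G.Adj]
  {u v a b c p q r s t x y z x' y' p' P P' Q R q₁ q₂ Q₁ Q₂ : V}

/-- If p' had degree two, then p, p' would be another pair, sharing the end y with x, x'. The set
N[x] ∪ N[p'] weighs 34 = 28 + 6, and the hits q, y', P₂, Q₂ cost 6 if they are distinct. This fails
only if z is y' (a six-cycle, with just q and Q hit) or adjacent to y' (the seven-cycle). -/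
theorem PairEnd.degree_p'_eq_three (h : G.IsMinCounterexample) (h1 : PairEnd G x x' y p p' q)
    (h2 : PairEnd G x' x y' P P' Q) (hyy : y ≠ y') : G.degree p' = 3 := by
  rcases h1.degree_p' with dp' | dp'
  swap
  · exact dp'.1
  exfalso
  obtain ⟨z, np'⟩ := exists_nbr2 dp' h1.nbr_p.adj₂.symm
  obtain ⟨P₂, P₂', Q₂, h3⟩ := h.exists_pairEnd np' h1.nbr_p.symm
  have nx' := h2.nbr_x
  have np := h1.nbr_p
  have ny := h1.nbr_y
  have ny' := h2.nbr_y
  have nz := h3.nbr_y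
  have hQ₂ := h3.degree_q
  have dP₂ := h3.nbr_p.degree
  have c4 := h.c4
  have irr := G.loopless.irrefl
  have sym := fun a b (h : G.Adj a b) => h.symm
  have dx := h1.nbr_x.degree
  have dx' := h2.nbr_x.degree
  have dy := h1.nbr_y.degree
  have dy' := h2.nbr_y.degree
  have dp := h1.nbr_p.degree
  have dP := h2.nbr_p.degree
  have dq := h1.degree_q
  have dQ := h2.degree_q
  have a1 := h1.nbr_x.adj₁
  have a2 := h1.nbr_y.adj₁
  have a3 := h1.nbr_y.adj₂
  have a4 := h1.nbr_y.adj₃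
  have a5 := h2.nbr_y.adj₁
  have a6 := h2.nbr_y.adj₂
  have a7 := h2.nbr_y.adj₃
  have a8 := h1.nbr_p.adj₂
  have a9 := h2.nbr_p.adj₂
  obtain ⟨ex, ix⟩ := h1.nbr_x
  obtain ⟨ex', ix'⟩ := h2.nbr_x
  obtain ⟨ep, ip⟩ := h1.nbr_p
  obtain ⟨eP, iP⟩ := h2.nbr_p
  obtain ⟨ey1, ey2, ey3, iy⟩ := h1.nbr_y
  obtain ⟨ey1', ey2', ey3', iy'⟩ := h2.nbr_y
  have hyz : y ≠ z := by
    rintro rfl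
    rcases (iy p').1 np'.adj₂.symm with rfl | rfl | rfl
    · rcases (ix p).1 np'.adj₁ with rfl | rfl
      · rcases (ix' y).1 h1.nbr_p.adj₁ with rfl | rfl
        · omega
        · exact hyy rfl
      · omega
    · exact irr _ np'.adj₁
    · omega
  have hxq : ¬ G.Adj x q := by
    intro h4
    rcases (ix q).1 h4 with rfl | rfl
    · omega
    · exact irr _ a4
  -- For the pair p, p' the end y has x as its neighbor of degree two and again q as its neighbor of
  -- degree three.
  have hqq : q ≠ Q₂ := PairEnd.q_ne h ⟨h1.nbr_p.symm, dp', h1.nbr_y.swap₁₂, h1.nbr_x.symm,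
    h1.degree_q, hxq, .inl h1.degree_x'⟩ h3 hyz
  have dz := nz.degree
  by_cases hzy : z = y'
  · subst hzy
    have hp' : p' = P := by
      have := (iy' p').1 np'.adj₂.symm
      have := np'.adj_iff
      grind
    subst hp'
    have hqQ := PairEnd.q_ne h h1 h2 hyy
    have ip' := np'.adj_iff
    have hnd : [y, x, x', p, p', z].Nodup := by
      simp only [List.nodup_cons, List.mem_cons, not_or, List.not_mem_nil, not_false_eq_true,
        List.nodup_nil, and_true]
      repeat' apply And.intro
      all_goals grind
    refine h.reduce [x, p'] [y, x, x', p, p', z] [(y, q), (z, Q)] (by simp) hnd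
      (by simp) ?_ ?_ ?_ ?_ ?_
    · simp [ix, ip']; grind
    · simp [ix, ip']
    · simp [ix, ix', ip, ip', iy, iy']
    · simp [ix, ix', ip, ip', iy, iy']
    · simp [hitCost, degWeight, dx, dx', dy, dy', dp, dP, dq, dQ, hqQ.symm]
  by_cases hadj : G.Adj y' z
  · have hzQ : z = Q := by
      rcases (iy' z).1 hadj with rfl | rfl | rfl
      · omega
      · omega
      · rfl
    subst hzQ
    have hyQ : y' = Q₂ := by
      rcases (nz.adj_iff y').1 hadj.symm with rfl | rfl | rfl
      · omega
      · omega
      · rfl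
    subst hyQ
    exact h.sevenCycle h1.nbr_x nx' ny np np' nz ny' h2.nbr_p dq dP₂ h2.not_adj hyy
  · have ip' := np'.adj_iff
    have iz := nz.adj_iff
    have a10 := np'.adj₂
    have a11 := nz.adj₃
    have hnd : [y, x, x', p, p', z].Nodup := by
      simp only [List.nodup_cons, List.mem_cons, not_or, List.not_mem_nil, not_false_eq_true,
        List.nodup_nil, and_true]
      repeat' apply And.intro
      all_goals grind
    refine h.reduce [x, p'] [y, x, x', p, p', z] [(y, q), (x', y'), (z, P₂), (z, Q₂)] (by simp) hnd
      (by simp) ?_ ?_ ?_ ?_ ?_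
    · simp [ix, ip']; grind
    · simp [ix, ip']
    · simp [ix, ix', ip, ip', iy, iz]
    · simp [ix, ix', ip, ip', iy, iz]
    · have e1 : y' ≠ q := by grind
      have e2 : y' ≠ Q₂ := by grind
      have e3 : y' ≠ P₂ := by rintro rfl; omega
      have e4 : q ≠ P₂ := by rintro rfl; omega
      have e5 := nz.ne₂₃
      simp [hitCost, degWeight, dx, dx', dy, dy', dp, dp', dq, dz, dP₂, hQ₂, e1, e2.symm, e3.symm,
        e4.symm, e5.symm, hqq.symm]

/-- The reduction that removes the closed neighborhoods of both outer neighbors of a pair. -/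
theorem reduce_outer (h : G.IsMinCounterexample) (h1 : PairEnd G x x' y p p' q)
    (h2 : PairEnd G x' x y' P P' Q) (hyy : y ≠ y') (hpP : p ≠ P) (nq : G.Nbr3 q y q₁ q₂)
    (nQ : G.Nbr3 Q y' Q₁ Q₂)
    (hcost : hitCost (fun v => G.degree v) [p', q₁, q₂, P', Q₁, Q₂] ≤ 16) : False := by
  have hqQ := PairEnd.q_ne h h1 h2 hyy
  have c4 := h.c4
  have irr := G.loopless.irrefl
  have sym := fun a b (h : G.Adj a b) => h.symm
  have dx := h1.nbr_x.degree
  have dx' := h2.nbr_x.degree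
  have dy := h1.nbr_y.degree
  have dy' := h2.nbr_y.degree
  have dp := h1.nbr_p.degree
  have dP := h2.nbr_p.degree
  have dq := h1.degree_q
  have dQ := h2.degree_q
  have a1 := h1.nbr_x.adj₁
  have a2 := h1.nbr_y.adj₁
  have a3 := h1.nbr_y.adj₂
  have a4 := h1.nbr_y.adj₃
  have a5 := h2.nbr_y.adj₁
  have a6 := h2.nbr_y.adj₂
  have a7 := h2.nbr_y.adj₃
  have a8 := h1.nbr_p.adj₂
  have a9 := h2.nbr_p.adj₂
  obtain ⟨ex, ix⟩ := h1.nbr_x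
  obtain ⟨ex', ix'⟩ := h2.nbr_x
  obtain ⟨ep, ip⟩ := h1.nbr_p
  obtain ⟨eP, iP⟩ := h2.nbr_p
  obtain ⟨ey1, ey2, ey3, iy⟩ := h1.nbr_y
  obtain ⟨ey1', ey2', ey3', iy'⟩ := h2.nbr_y
  have iq := nq.adj_iff
  have iQ := nQ.adj_iff
  have hnd : [y, x, p, q, y', x', P, Q].Nodup := by
    simp only [List.nodup_cons, List.mem_cons, not_or, List.not_mem_nil, not_false_eq_true,
      List.nodup_nil, and_true]
    repeat' apply And.intro
    all_goals grind
  refine h.reduce [y, y'] [y, x, p, q, y', x', P, Q]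
    [(p, p'), (q, q₁), (q, q₂), (P, P'), (Q, Q₁), (Q, Q₂)] (by simp) hnd (by simp) ?_ ?_ ?_ ?_ ?_
  · simp [iy, iy']; grind
  · simp [iy, iy']
  · simp [ix, ix', ip, iP, iq, iQ]
  · simp [ix, ix', ip, iP, iq, iQ, iy, iy']
  · simp only [List.map_cons, List.map_nil, degWeight, dx, dx', dy, dy', dp, dP, dq, dQ]
    simp only [List.length_cons, List.length_nil, List.sum_cons, List.sum_nil]
    omega

/-- In this configuration S = {y, y'} hits both p' and P' twice and costs 18 instead of 16. But p'
is heavy as seen from Q, so its third neighbor r has degree two, and so has the next vertex r'.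
Adding r to S absorbs p', r and r': weight 61 = 42 + 19 in the worst case w = P'. -/
theorem reduce_two_supports (h : G.IsMinCounterexample) (h1 : PairEnd G x x' y p p' q)
    (h2 : PairEnd G x' x y' P P' Q) (hyy : y ≠ y') (hpP : p ≠ P) (hpp : p' ≠ P')
    (nq : G.Nbr3 q y q₁ P') (nQ : G.Nbr3 Q y' Q₁ p') (dq₁ : G.degree q₁ = 1)
    (dQ₁ : G.degree Q₁ = 1) (dp' : G.degree p' = 3) (dP' : G.degree P' = 3) : False := by
  have hqQ := PairEnd.q_ne h h1 h2 hyy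
  have hpQ : p ≠ Q := by
    rintro rfl
    have := h1.nbr_p.degree
    have := h2.degree_q
    omega
  obtain ⟨r, np'⟩ := exists_nbr3_of_adj dp' h1.nbr_p.adj₂.symm nQ.adj₃.symm hpQ
  have dr : G.degree r = 2 := by
    obtain ⟨s, t, hst, hd⟩ := h.heavy_of_support (nbr1_of_adj dQ₁ nQ.adj₂.symm)
      nQ.rotate.rotate
    have := h1.nbr_p.degree
    rcases (hst.adj_iff p).1 np'.adj₁ with rfl | rfl | rfl
    · exact absurd rfl hpQ
    · rcases (hst.adj_iff r).1 np'.adj₃ with rfl | rfl | rfl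
      · exact absurd rfl np'.ne₂₃
      · exact absurd rfl np'.ne₁₃
      · omega
    · rcases (hst.adj_iff r).1 np'.adj₃ with rfl | rfl | rfl
      · exact absurd rfl np'.ne₂₃
      · omega
      · exact absurd rfl np'.ne₁₃
  obtain ⟨r', nr⟩ := exists_nbr2 dr np'.adj₃.symm
  have dr' : G.degree r' = 2 := by
    rcases h.degree_two_or np'.swap₂₃ h1.nbr_p.symm nr with hd | hd
    · have := h1.nbr_y.degree
      omega
    · exact hd
  obtain ⟨w, nr'⟩ := exists_nbr2 dr' nr.adj₂.symm
  have dw : G.degree w = 3 := by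
    have h3 := h.two_le_degree_of_adj dr' nr'.adj₂
    have h4 := h.degree_le w
    by_contra h5
    exact h.not_three_consecutive nr' dr (by omega)
  have c4 := h.c4
  have irr := G.loopless.irrefl
  have sym := fun a b (h : G.Adj a b) => h.symm
  have dx := h1.nbr_x.degree
  have dx' := h2.nbr_x.degree
  have dy := h1.nbr_y.degree
  have dy' := h2.nbr_y.degree
  have dp := h1.nbr_p.degree
  have dP := h2.nbr_p.degree
  have dq := h1.degree_q
  have dQ := h2.degree_q
  have a1 := h1.nbr_x.adj₁
  have a2 := h1.nbr_y.adj₁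
  have a3 := h1.nbr_y.adj₂
  have a4 := h1.nbr_y.adj₃
  have a5 := h2.nbr_y.adj₁
  have a6 := h2.nbr_y.adj₂
  have a7 := h2.nbr_y.adj₃
  have a8 := h1.nbr_p.adj₂
  have a9 := h2.nbr_p.adj₂
  obtain ⟨ex, ix⟩ := h1.nbr_x
  obtain ⟨ex', ix'⟩ := h2.nbr_x
  obtain ⟨ep, ip⟩ := h1.nbr_p
  obtain ⟨eP, iP⟩ := h2.nbr_p
  obtain ⟨ey1, ey2, ey3, iy⟩ := h1.nbr_y
  obtain ⟨ey1', ey2', ey3', iy'⟩ := h2.nbr_y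
  have a10 := np'.adj₃
  have a11 := nr.adj₂
  have a12 := nr'.adj₂
  have a13 := nQ.adj₃
  have a14 := nq.adj₃
  obtain ⟨eq1, eq2, eq3, iq⟩ := nq
  obtain ⟨eQ1, eQ2, eQ3, iQ⟩ := nQ
  obtain ⟨ep1, ep2, ep3, ip'⟩ := np'
  obtain ⟨er, ir⟩ := nr
  obtain ⟨er', ir'⟩ := nr'
  have hPp : P ≠ r := by
    rintro rfl
    have := iP p'
    grind
  have hnd : [y, x, p, q, y', x', P, Q, p', r, r'].Nodup := by
    simp only [List.nodup_cons, List.mem_cons, not_or, List.not_mem_nil, not_false_eq_true,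
      List.nodup_nil, and_true]
    repeat' apply And.intro
    all_goals grind
  have e1 : q₁ ≠ Q₁ := by
    rintro rfl
    have := (nbr1_of_adj dq₁ ((iq q₁).2 (by simp)).symm).adj_iff Q
    have := (iQ q₁).2 (by simp)
    have := this.symm
    grind
  have e2 : q₁ ≠ P' := by rintro rfl; omega
  have e3 : Q₁ ≠ P' := by rintro rfl; omega
  have e4 : q₁ ≠ w := by rintro rfl; omega
  have e5 : Q₁ ≠ w := by rintro rfl; omega
  refine h.reduce [y, y', r] [y, x, p, q, y', x', P, Q, p', r, r']
    [(q, P'), (P, P'), (q, q₁), (Q, Q₁), (r', w)] (by simp) hnd (by simp) ?_ ?_ ?_ ?_ ?_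
  · simp [iy, iy', ir]; grind
  · simp [iy, iy', ir]
  · simp [ix, ix', ip, iP, iq, iQ, ip', ir, ir']
  · simp [ix, ix', ip, iP, iq, iQ, iy, iy', ip', ir, ir']
  · simp [hitCost, degWeight, List.count_cons, dx, dx', dy, dy', dp, dP, dq, dQ, dp', dP', dr, dr',
      dw, dq₁, dQ₁, e1.symm, e2, e3, e4.symm, e5.symm]
    split_ifs <;> omega

/-- A pair of adjacent vertices of degree two lies in a five-cycle. -/
theorem PairEnd.p_eq (h : G.IsMinCounterexample) (h1 : PairEnd G x x' y p p' q)
    (h2 : PairEnd G x' x y' P P' Q) (hyy : y ≠ y') : p = P := by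
  by_contra hpP
  have dp' := PairEnd.degree_p'_eq_three h h1 h2 hyy
  have dP' := PairEnd.degree_p'_eq_three h h2 h1 hyy.symm
  have hqQ := PairEnd.q_ne h h1 h2 hyy
  obtain ⟨q₁, q₂, nq, hq⟩ : Heavy G y q := by
    rcases h1.degree_p' with h3 | h3
    · omega
    · exact h3.2
  obtain ⟨Q₁, Q₂, nQ, hQ⟩ : Heavy G y' Q := by
    rcases h2.degree_p' with h3 | h3
    · omega
    · exact h3.2
  have hpp : p' ≠ P' := by
    rintro rfl
    obtain ⟨t, nt⟩ := exists_nbr3_of_adj dp' h1.nbr_p.adj₂.symm h2.nbr_p.adj₂.symm hpP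
    have := h.degree_two_or nt h1.nbr_p.symm h2.nbr_p.symm
    have := h1.nbr_y.degree
    have := h2.nbr_y.degree
    omega
  have c4 := h.c4
  have sym := fun a b (h : G.Adj a b) => h.symm
  have a3 := h1.nbr_y.adj₂
  have a4 := h1.nbr_y.adj₃
  have a6 := h2.nbr_y.adj₂
  have a7 := h2.nbr_y.adj₃
  have a8 := h1.nbr_p.adj₂
  have a9 := h2.nbr_p.adj₂
  have b1 := nq.adj₂
  have b2 := nq.adj₃
  have b3 := nQ.adj₂
  have b4 := nQ.adj₃
  have e0 := h1.nbr_y.ne₂₃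
  have e0' := h2.nbr_y.ne₂₃
  have e1 := h1.nbr_p.ne
  have e2 := h2.nbr_p.ne
  have f1 : q₁ ≠ p' := by grind
  have f2 : q₂ ≠ p' := by grind
  have f3 : Q₁ ≠ P' := by grind
  have f4 : Q₂ ≠ P' := by grind
  have f5 := nq.ne₂₃
  have f6 := nQ.ne₂₃
  have f7 : ¬ (Q₁ = q₁ ∧ Q₂ = q₂) := by grind
  have f8 : ¬ (Q₁ = q₂ ∧ Q₂ = q₁) := by grind
  have leaf : ∀ l, G.degree l = 1 → G.Adj q l → G.Adj Q l → False := by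
    intro l hl h3 h4
    exact hqQ (((nbr1_of_adj hl h4.symm).adj_iff q).1 h3.symm)
  -- The six hits cost 1 + 1 + 6 + 6 = 14 if they are distinct, so one coincidence is affordable.
  -- Degrees and the absence of 4-cycles allow two only in this case.
  by_cases hbad : Q₂ = p' ∧ q₂ = P' ∧ G.degree q₁ = 1 ∧ G.degree Q₁ = 1
  · obtain ⟨rfl, rfl, hq₁, hQ₁⟩ := hbad
    exact h.reduce_two_supports h1 h2 hyy hpP hpp nq nQ hq₁ hQ₁ dp' dP'
  refine h.reduce_outer h1 h2 hyy hpP nq nQ ?_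
  rcases hq with ⟨hq₁, hq₂⟩ | ⟨hq₁, hq₂⟩ <;> rcases hQ with ⟨hQ₁, hQ₂⟩ | ⟨hQ₁, hQ₂⟩
  · have g1 : Q₁ ≠ q₁ := by rintro rfl; exact leaf _ hq₁ b1 b3
    have g2 : Q₁ ≠ p' := by rintro rfl; omega
    have g3 : q₁ ≠ P' := by rintro rfl; omega
    have g4 : Q₁ ≠ q₂ := by rintro rfl; omega
    have g5 : Q₂ ≠ q₁ := by rintro rfl; omega
    simp [hitCost, List.count_cons, hq₁, hq₂, hQ₁, hQ₂, dp', dP', f1, f2, f3, f4, f5.symm, f6.symm,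
      g1, g2, g3.symm, g4, g5, hpp.symm]
    grind
  · have g1 : Q₁ ≠ q₁ := by rintro rfl; omega
    have g2 : Q₁ ≠ p' := by rintro rfl; omega
    have g3 : q₁ ≠ P' := by rintro rfl; omega
    have g4 : Q₁ ≠ q₂ := by rintro rfl; omega
    have g5 : Q₂ ≠ q₁ := by rintro rfl; omega
    have g6 : Q₂ ≠ p' := by rintro rfl; omega
    have g7 : Q₂ ≠ q₂ := by rintro rfl; omega
    simp [hitCost, List.count_cons, hq₁, hq₂, hQ₁, hQ₂, dp', dP', f1, f2, f3, f4, f5.symm, f6.symm,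
      g1, g2, g3.symm, g4, g5, g6, g7, hpp.symm]
    grind
  · have g1 : Q₁ ≠ q₁ := by rintro rfl; omega
    have g2 : Q₁ ≠ p' := by rintro rfl; omega
    have g3 : q₁ ≠ P' := by rintro rfl; omega
    have g4 : Q₁ ≠ q₂ := by rintro rfl; omega
    have g5 : Q₂ ≠ q₁ := by rintro rfl; omega
    have g6 : q₂ ≠ P' := by rintro rfl; omega
    have g7 : Q₂ ≠ q₂ := by rintro rfl; omega
    simp [hitCost, List.count_cons, hq₁, hq₂, hQ₁, hQ₂, dp', dP', f1, f2, f3, f4, f5.symm, f6.symm,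
      g1, g2, g3.symm, g4, g5, g6.symm, g7, hpp.symm]
    grind
  · have g2 : Q₁ ≠ p' := by rintro rfl; omega
    have g3 : q₁ ≠ P' := by rintro rfl; omega
    have g4 : Q₂ ≠ p' := by rintro rfl; omega
    have g5 : q₂ ≠ P' := by rintro rfl; omega
    simp [hitCost, List.count_cons, hq₁, hq₂, hQ₁, hQ₂, dp', dP', f1, f2, f3, f4, f5.symm, f6.symm,
      g2, g3.symm, g4, g5.symm, hpp.symm]
    grind

end IsMinCounterexample

/-! ### Tiles: the global argument for leaves and adjacent vertices of degree two. -/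

namespace IsMinCounterexample

variable {V : Type*} [Fintype V] [DecidableEq V] {G : SimpleGraph V} [DecidableRel G.Adj]
  {u v a b c p q r s t x y z x' y' p' P P' Q : V}

/-- A set of vertices is low-closed if no edge with an endpoint of degree at most two leaves it. -/
def LowClosed (G : SimpleGraph V) [DecidableRel G.Adj] (X : Finset V) : Prop :=
  ∀ a b, G.Adj a b → (G.degree a ≤ 2 ∨ G.degree b ≤ 2) → a ∈ X → b ∈ X

/-- A low-closed set `U` that is the closed neighborhood of a sufficiently small independent
set `s`. -/
structure Tile (G : SimpleGraph V) [DecidableRel G.Adj] (s U : Finset V) : Prop where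
  subset : s ⊆ U
  indep : ∀ a ∈ s, ∀ b ∈ s, ¬ G.Adj a b
  closed : ∀ a ∈ s, ∀ z, G.Adj a z → z ∈ U
  dom : ∀ u ∈ U, u ∈ s ∨ ∃ a ∈ s, G.Adj u a
  weight : 14 * s.card ≤ ∑ u ∈ U, degWeight (G.degree u)
  lowClosed : LowClosed G U

/-- Low-closed sets do not separate `U`. -/
def LowConn (G : SimpleGraph V) [DecidableRel G.Adj] (U : Finset V) : Prop :=
  ∀ X, LowClosed G X → ∀ u ∈ U, u ∈ X → U ⊆ X

theorem Tile.union {s' U U' : Finset V} {s : Finset V} (h : Tile G s U) (h' : Tile G s' U')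
    (hd : Disjoint U U') : Tile G (s ∪ s') (U ∪ U') := by
  have hds : Disjoint s s' := (hd.mono_left h.subset).mono_right h'.subset
  have key : ∀ a ∈ s, ∀ b ∈ s', ¬ G.Adj a b := fun a ha b hb hab =>
    Finset.disjoint_left.1 hd (h.closed a ha b hab) (h'.subset hb)
  refine ⟨Finset.union_subset_union h.subset h'.subset, ?_, ?_, ?_, ?_, ?_⟩
  · intro a ha b hb
    rcases Finset.mem_union.1 ha with ha | ha <;> rcases Finset.mem_union.1 hb with hb | hb
    · exact h.indep a ha b hb
    · exact key a ha b hb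
    · exact fun hab => key b hb a ha hab.symm
    · exact h'.indep a ha b hb
  · intro a ha z hz
    rcases Finset.mem_union.1 ha with ha | ha
    · exact Finset.mem_union_left _ (h.closed a ha z hz)
    · exact Finset.mem_union_right _ (h'.closed a ha z hz)
  · intro u hu
    rcases Finset.mem_union.1 hu with hu | hu
    · rcases h.dom u hu with h1 | ⟨a, ha, h1⟩
      · exact .inl (Finset.mem_union_left _ h1)
      · exact .inr ⟨a, Finset.mem_union_left _ ha, h1⟩
    · rcases h'.dom u hu with h1 | ⟨a, ha, h1⟩
      · exact .inl (Finset.mem_union_right _ h1)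
      · exact .inr ⟨a, Finset.mem_union_right _ ha, h1⟩
  · rw [Finset.card_union_of_disjoint hds, Finset.sum_union hd, mul_add]
    exact add_le_add h.weight h'.weight
  · intro a b hab hlow ha
    rcases Finset.mem_union.1 ha with ha | ha
    · exact Finset.mem_union_left _ (h.lowClosed a b hab hlow ha)
    · exact Finset.mem_union_right _ (h'.lowClosed a b hab hlow ha)

/-- In a minimal counterexample no nonempty family of tiles covers all neighbors of its members. -/
theorem tile_family_false (h : G.IsMinCounterexample) (T : Finset V → Finset V → Prop)
    (ht : ∀ s U, T s U → Tile G s U ∧ LowConn G U)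
    (hbd : ∀ s U, T s U → ∀ u ∈ U, ∀ z ∉ U, G.Adj u z → ∃ s' U', T s' U' ∧ z ∈ U')
    (hex : ∃ s U, T s U ∧ U.Nonempty) : False := by
  classical
  -- Candidates are tiles covered by members of the family; a largest one will have no outgoing
  -- edge.
  let F : Finset (Finset V) := Finset.univ.filter fun U =>
    (∃ s, Tile G s U) ∧ U.Nonempty ∧ ∀ u ∈ U, ∃ s' U', T s' U' ∧ u ∈ U'
  have hF : F.Nonempty := by
    obtain ⟨s, U, h1, h2⟩ := hex
    exact ⟨U, by simpa [F] using ⟨⟨s, (ht s U h1).1⟩, h2, fun u hu => ⟨s, U, h1, hu⟩⟩⟩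
  obtain ⟨U, hU, hmax⟩ := F.exists_max_image Finset.card hF
  simp only [F, Finset.mem_filter, Finset.mem_univ, true_and] at hU hmax
  obtain ⟨⟨s, hs⟩, hne, hcov⟩ := hU
  by_cases hout : ∃ a ∈ U, ∃ b ∉ U, G.Adj a b
  · obtain ⟨a, ha, b, hb, hab⟩ := hout
    have hbcov : ∃ s' U', T s' U' ∧ b ∈ U' := by
      obtain ⟨s₁, U₁, h1, ha1⟩ := hcov a ha
      by_cases hb1 : b ∈ U₁
      · exact ⟨s₁, U₁, h1, hb1⟩
      · exact hbd s₁ U₁ h1 a ha1 b hb1 hab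
    obtain ⟨s', U', h1, hb'⟩ := hbcov
    obtain ⟨ht', hc'⟩ := ht s' U' h1
    have hd : Disjoint U U' := by
      rw [Finset.disjoint_left]
      -- If U met U', then U, being low-closed, would contain all of U' and hence b.
      exact fun w hw hw' => hb (hc' U hs.lowClosed w hw' hw hb')
    have h2 := hmax (U ∪ U') ⟨⟨_, hs.union ht' hd⟩, hne.mono Finset.subset_union_left, by
      intro u hu
      rcases Finset.mem_union.1 hu with hu | hu
      · exact hcov u hu
      · exact ⟨s', U', h1, hu⟩⟩
    have h3 : U'.card ≠ 0 := Finset.card_ne_zero_of_mem hb'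
    rw [Finset.card_union_of_disjoint hd] at h2
    omega
  · refine h.reduce_finset s U [] hne hs.subset hs.indep hs.closed hs.dom ?_ ?_
    · intro v hv
      rw [List.count_nil, Nat.le_zero, Finset.card_eq_zero, Finset.eq_empty_iff_forall_notMem]
      intro w hw
      rw [Finset.mem_inter, mem_neighborFinset] at hw
      exact hout ⟨w, hw.2, v, hv, hw.1.symm⟩
    · simpa [hitCost] using hs.weight

/-- Tiles whose outer neighbors are seen as heavy neighbors of vertices of degree three. -/
def HeavyTile (G : SimpleGraph V) [DecidableRel G.Adj] (s U : Finset V) : Prop :=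
  (Tile G s U ∧ LowConn G U) ∧
    ∀ u ∈ U, ∀ z ∉ U, G.Adj u z → Heavy G u z

/-- The weight 9 + 5 = 14 is exact. Both edges that leave the tile join vertices of degree three. -/
theorem heavyTile_leaf (h : G.IsMinCounterexample) (hv : G.Nbr1 v u) :
    HeavyTile G {v} {v, u} := by
  obtain ⟨a, b, hu⟩ := exists_nbr3 (h.degree_of_leaf hv) hv.adj.symm
  have ha := h.degree_of_support hv hu
  have hb := h.degree_of_support hv hu.swap₂₃
  have hHa := h.heavy_of_support hv hu
  have hHb := h.heavy_of_support hv hu.swap₂₃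
  have hvu : v ≠ u := hv.adj.ne
  refine ⟨⟨⟨by simp, by simp, by simp [hv.adj_iff], by simp [hv.adj.symm], ?_, ?_⟩, ?_⟩, ?_⟩
  · rw [Finset.sum_pair hvu, hv.degree, hu.degree]
    simp [degWeight]
  · intro c d hcd hlow hc
    simp only [Finset.mem_insert, Finset.mem_singleton] at hc ⊢
    rcases hc with rfl | rfl
    · exact .inr ((hv.adj_iff d).1 hcd)
    · have := hu.degree
      rcases (hu.adj_iff d).1 hcd with rfl | rfl | rfl
      · exact .inl rfl
      · omega
      · omega
  · intro X hX w hw hwX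
    have h1 := hv.degree
    simp only [Finset.mem_insert, Finset.mem_singleton] at hw
    rcases hw with rfl | rfl
    · have := hX _ _ hv.adj (.inl (by omega)) hwX
      simp [Finset.insert_subset_iff, *]
    · have := hX _ _ hv.adj.symm (.inr (by omega)) hwX
      simp [Finset.insert_subset_iff, *]
  · intro w hw z hz hwz
    simp only [Finset.mem_insert, Finset.mem_singleton, not_or] at hw hz
    rcases hw with rfl | rfl
    · exact absurd ((hv.adj_iff z).1 hwz) hz.2
    · rcases (hu.adj_iff z).1 hwz with rfl | rfl | rfl
      · exact absurd rfl hz.1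
      · exact hHa
      · exact hHb

/-- The tile is the five-cycle through the pair, dominated by x and p, of weight 3 · 6 + 2 · 5 = 28.
Since p' has degree three, the definition of `PairEnd` makes q and Q heavy. -/
theorem exists_heavyTile_pair (h : G.IsMinCounterexample) (hx' : G.degree x' = 2)
    (hx : G.Nbr2 x x' b) : ∃ s U, HeavyTile G s U ∧ b ∈ U := by
  obtain ⟨y, p, p', q, y', P, P', Q, h1, h2, hyy⟩ := h.exists_pairEnds hx.degree hx' hx.adj₁
  obtain rfl : b = y := by
    rcases (h1.nbr_x.adj_iff b).1 hx.adj₂ with h3 | h3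
    · exact absurd h3.symm hx.ne
    · exact h3
  obtain rfl := PairEnd.p_eq h h1 h2 hyy
  have hp' : p' = y' := by
    rcases (h1.nbr_p.adj_iff y').1 h2.nbr_p.adj₁ with h3 | h3
    · exact absurd h3.symm hyy
    · exact h3.symm
  have hP' : P' = b := by
    rcases (h2.nbr_p.adj_iff b).1 h1.nbr_p.adj₁ with h3 | h3
    · exact absurd h3 hyy
    · exact h3.symm
  -- From here on P' and p' are the names of the two ends of the pair.
  subst hp' hP'
  have dx := h1.nbr_x.degree
  have dx' := h2.nbr_x.degree
  have dy := h1.nbr_y.degree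
  have dy' := h2.nbr_y.degree
  have dp := h1.nbr_p.degree
  have dq := h1.degree_q
  have dQ := h2.degree_q
  have hq : Heavy G P' q := by
    rcases h1.degree_p' with h3 | h3
    · omega
    · exact h3.2
  have hQ : Heavy G p' Q := by
    rcases h2.degree_p' with h3 | h3
    · omega
    · exact h3.2
  obtain ⟨ex, ix⟩ := h1.nbr_x
  obtain ⟨ex', ix'⟩ := h2.nbr_x
  obtain ⟨ep, ip⟩ := h1.nbr_p
  obtain ⟨ey1, ey2, ey3, iy⟩ := h1.nbr_y
  obtain ⟨ey1', ey2', ey3', iy'⟩ := h2.nbr_y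
  have e1 : P' ≠ x := by rintro rfl; omega
  have e2 : P' ≠ p := by rintro rfl; omega
  have e3 : p' ≠ x' := by rintro rfl; omega
  have e4 : p' ≠ p := by rintro rfl; omega
  have e5 : x ≠ x' := ((ix x').2 (by simp)).ne
  have e6 : p' ≠ x := by rintro rfl; omega
  have e7 : p ≠ x := ey1.symm
  refine ⟨{x, p}, {P', x, x', p', p}, ⟨⟨⟨?_, ?_, ?_, ?_, ?_, ?_⟩, ?_⟩, ?_⟩, by simp⟩
  · simp [Finset.insert_subset_iff]
  · simp [ix, ip, e1.symm, e6.symm, e2.symm, ey1'.symm]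
  · simp [ix, ip]
  · simp [ix, ix', ip, iy, iy']
  · rw [Finset.sum_insert (by simp [e1, e2, ex.symm, hyy]), Finset.sum_insert
      (by simp [ey1, e5, e6.symm]), Finset.sum_insert (by simp [e3.symm, ey1']),
      Finset.sum_pair e4, Finset.card_pair ey1, dx, dx', dy, dy', dp]
    simp [degWeight]
  · intro c d hcd hlow hc
    simp only [Finset.mem_insert, Finset.mem_singleton] at hc ⊢
    rcases hc with rfl | rfl | rfl | rfl | rfl
    · rcases (iy d).1 hcd with rfl | rfl | rfl
      · simp
      · simp
      · omega
    · rcases (ix d).1 hcd with rfl | rfl <;> simp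
    · rcases (ix' d).1 hcd with rfl | rfl <;> simp
    · rcases (iy' d).1 hcd with rfl | rfl | rfl
      · simp
      · simp
      · omega
    · rcases (ip d).1 hcd with rfl | rfl <;> simp
  · intro X hX w hw hwX
    have c1 : P' ∈ X ↔ x ∈ X := ⟨hX _ _ ((iy x).2 (by simp)) (.inr (by omega)),
      hX _ _ ((ix P').2 (by simp)) (.inl (by omega))⟩
    have c2 : x ∈ X ↔ x' ∈ X := ⟨hX _ _ ((ix x').2 (by simp)) (.inr (by omega)),
      hX _ _ ((ix' x).2 (by simp)) (.inl (by omega))⟩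
    have c3 : x' ∈ X ↔ p' ∈ X := ⟨hX _ _ ((ix' p').2 (by simp)) (.inl (by omega)),
      hX _ _ ((iy' x').2 (by simp)) (.inr (by omega))⟩
    have c4 : P' ∈ X ↔ p ∈ X := ⟨hX _ _ ((iy p).2 (by simp)) (.inr (by omega)),
      hX _ _ ((ip P').2 (by simp)) (.inl (by omega))⟩
    simp only [Finset.mem_insert, Finset.mem_singleton] at hw
    simp only [Finset.insert_subset_iff, Finset.singleton_subset_iff]
    have hX' : P' ∈ X := by
      rcases hw with rfl | rfl | rfl | rfl | rfl
      · exact hwX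
      · exact c1.2 hwX
      · exact c1.2 (c2.2 hwX)
      · exact c1.2 (c2.2 (c3.2 hwX))
      · exact c4.2 hwX
    exact ⟨hX', c1.1 hX', c2.1 (c1.1 hX'), c3.1 (c2.1 (c1.1 hX')), c4.1 hX'⟩
  · intro w hw z hz hwz
    simp only [Finset.mem_insert, Finset.mem_singleton, not_or] at hw hz
    rcases hw with rfl | rfl | rfl | rfl | rfl
    · rcases (iy z).1 hwz with rfl | rfl | rfl
      · simp at hz
      · simp at hz
      · exact hq
    · rcases (ix z).1 hwz with rfl | rfl <;> simp at hz
    · rcases (ix' z).1 hwz with rfl | rfl <;> simp at hz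
    · rcases (iy' z).1 hwz with rfl | rfl | rfl
      · simp at hz
      · simp at hz
      · exact hQ
    · rcases (ip z).1 hwz with rfl | rfl <;> simp at hz

/-- A leaf at b gives a pendent edge. Two neighbors of degree two give, by `degree_two_or`, a pair
with end b and hence a five-cycle through b. -/
theorem exists_heavyTile_of_heavy (h : G.IsMinCounterexample) (hb : Heavy G u b) :
    ∃ s U, HeavyTile G s U ∧ b ∈ U := by
  obtain ⟨p, q, nb, ⟨hp, -⟩ | ⟨hp, hq⟩⟩ := hb
  · exact ⟨_, _, h.heavyTile_leaf (nbr1_of_adj hp nb.adj₂.symm), by simp⟩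
  · obtain ⟨p', np⟩ := exists_nbr2 hp nb.adj₂.symm
    obtain ⟨q', nq⟩ := exists_nbr2 hq nb.adj₃.symm
    rcases h.degree_two_or nb.rotate.rotate np nq with hd | hd
    · exact h.exists_heavyTile_pair hd np.symm
    · exact h.exists_heavyTile_pair hd nq.symm

theorem not_heavyTile (h : G.IsMinCounterexample) {U : Finset V} {s : Finset V}
    (hU : HeavyTile G s U) (hne : U.Nonempty) : False :=
  h.tile_family_false (HeavyTile G) (fun _ _ h1 => h1.1)
    (fun _ _ h1 u hu z hz huz => h.exists_heavyTile_of_heavy (h1.2 u hu z hz huz))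
    ⟨s, U, hU, hne⟩

/-! ### Isolated vertices of degree two, and the cubic case. -/

theorem two_le_degree (h : G.IsMinCounterexample) (v : V) : 2 ≤ G.degree v := by
  have h1 := h.one_le_degree v
  by_contra h2
  obtain ⟨u, hu⟩ := exists_adj_of_degree_pos h1
  exact h.not_heavyTile (h.heavyTile_leaf (nbr1_of_adj (by omega) hu)) (by simp)

theorem degree_three_of_adj_two (h : G.IsMinCounterexample) (hx : G.degree x = 2)
    (hxy : G.Adj x y) : G.degree y = 3 := by
  have h1 := h.two_le_degree y
  have h2 := h.degree_le y
  by_contra h3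
  obtain ⟨b, hb⟩ := exists_nbr2 hx hxy
  obtain ⟨s, U, hU, hbU⟩ := h.exists_heavyTile_pair (by omega) hb
  exact h.not_heavyTile hU ⟨b, hbU⟩

theorem eq_of_degree_two (h : G.IsMinCounterexample) (hya : G.Adj y a) (hyb : G.Adj y b)
    (ha : G.degree a = 2) (hb : G.degree b = 2) : a = b := by
  by_contra hab
  have hy := h.degree_three_of_adj_two ha hya.symm
  obtain ⟨c, hn⟩ := exists_nbr3_of_adj hy hya hyb hab
  obtain ⟨a', na⟩ := exists_nbr2 ha hya.symm
  obtain ⟨b', nb⟩ := exists_nbr2 hb hyb.symm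
  have h1 := h.degree_three_of_adj_two ha na.adj₂
  have h2 := h.degree_three_of_adj_two hb nb.adj₂
  have := h.degree_two_or hn na nb
  omega

/-- N[y] weighs 21. If a saw no vertex of degree two, its outer cost would be 2 and that of b at
most 3 + 1, so with x' the total would be 14 + 7. If ab is an edge, the bound is 1 + 3 + 3. -/
theorem exists_adj_degree_two (h : G.IsMinCounterexample) (hx : G.degree x = 2)
    (hy : G.Nbr3 y x a b) : ∃ s, G.Adj a s ∧ G.degree s = 2 := by
  by_contra! hno
  have key : ∀ c, G.Adj y c → c ≠ x → G.degree c = 3 := by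
    intro c hc hcx
    have h1 := h.two_le_degree c
    have h2 := h.degree_le c
    by_contra h3
    exact hcx (h.eq_of_degree_two hc hy.adj₁ (by omega) hx)
  have ha := key a hy.adj₂ hy.ne₁₂.symm
  have hb := key b hy.adj₃ hy.ne₁₃.symm
  obtain ⟨x', nx⟩ := exists_nbr2 hx hy.adj₁.symm
  have hx' := h.degree_three_of_adj_two hx nx.adj₂
  have hd := h.two_le_degree
  have hd3 := h.degree_le
  by_cases hab : G.Adj a b
  · obtain ⟨a', na⟩ := exists_nbr3_of_adj ha hy.adj₂.symm hab hy.adj₃.ne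
    obtain ⟨b', nb⟩ := exists_nbr3_of_adj hb hy.adj₃.symm hab.symm hy.adj₂.ne
    have := h.single3 hy nx.outList (na.outList_triangle hy.adj₃) (nb.outList_triangle hy.adj₂)
    have := hd a'
    have := hd b'
    simp [hx, ha, hb, hx', degWeight] at *
    omega
  · obtain ⟨a1, a2, na⟩ := exists_nbr3 ha hy.adj₂.symm
    obtain ⟨b1, b2, nb⟩ := exists_nbr3 hb hy.adj₃.symm
    have h1 := h.single3 hy nx.outList na.outList nb.outList
    have h2 := hno a1 na.adj₂
    have h3 := hno a2 na.adj₃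
    have h4 : ¬ (G.degree b1 = 2 ∧ G.degree b2 = 2) := fun h4 =>
      nb.ne₂₃ (h.eq_of_degree_two nb.adj₂ nb.adj₃ h4.1 h4.2)
    have := hd a1
    have := hd a2
    have := hd b1
    have := hd b2
    have := hd3 a1
    have := hd3 a2
    simp [hx, ha, hb, hx', degWeight] at h1
    omega

theorem tile_of_degree_two (h : G.IsMinCounterexample) (n : G.Nbr2 x y z) :
    Tile G {x} {x, y, z} ∧ LowConn G {x, y, z} := by
  have hx := n.degree
  have hy := h.degree_three_of_adj_two hx n.adj₁
  have hz := h.degree_three_of_adj_two hx n.adj₂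
  have hxy := n.adj₁.ne
  have hxz := n.adj₂.ne
  have low : ∀ w c, G.Adj x w → G.Adj w c → (G.degree w ≤ 2 ∨ G.degree c ≤ 2) → c = x := by
    intro w c hw hc hlow
    have h1 := h.degree_three_of_adj_two hx hw
    have h2 := h.two_le_degree c
    exact h.eq_of_degree_two hc hw.symm (by omega) hx
  refine ⟨⟨by simp, by simp, by simp [n.adj_iff], by simp [n.adj₁.symm, n.adj₂.symm], ?_, ?_⟩,
    ?_⟩
  · rw [Finset.sum_insert (by simp [hxy, hxz]), Finset.sum_pair n.ne, hx, hy, hz]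
    simp [degWeight]
  · intro c d hcd hlow hc
    simp only [Finset.mem_insert, Finset.mem_singleton] at hc ⊢
    rcases hc with rfl | rfl | rfl
    · exact .inr ((n.adj_iff d).1 hcd)
    · exact .inl (low _ _ n.adj₁ hcd hlow)
    · exact .inl (low _ _ n.adj₂ hcd hlow)
  · intro X hX w hw hwX
    have c1 : x ∈ X ↔ y ∈ X := ⟨hX _ _ n.adj₁ (.inl (by omega)),
      hX _ _ n.adj₁.symm (.inr (by omega))⟩
    have c2 : x ∈ X ↔ z ∈ X := ⟨hX _ _ n.adj₂ (.inl (by omega)),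
      hX _ _ n.adj₂.symm (.inr (by omega))⟩
    simp only [Finset.mem_insert, Finset.mem_singleton] at hw
    simp only [Finset.insert_subset_iff, Finset.singleton_subset_iff]
    rcases hw with rfl | rfl | rfl <;> tauto

/-- Tiles N[x] have weight 16 ≥ 14. By `exists_adj_degree_two` every outer neighbor of a tile is
adjacent to a vertex of degree two, so it lies in another tile. -/
theorem degree_ne_two (h : G.IsMinCounterexample) (hx : G.degree x = 2) : False := by
  refine h.tile_family_false (fun s U => ∃ x y z, G.Nbr2 x y z ∧ s = {x} ∧ U = {x, y, z}) ?_ ?_ ?_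
  · rintro s U ⟨x, y, z, n, rfl, rfl⟩
    exact h.tile_of_degree_two n
  · rintro s U ⟨x, y, z, n, rfl, rfl⟩ u hu w hw huw
    have step : ∀ u, G.Adj x u → G.Adj u w → ∃ t, G.Adj w t ∧ G.degree t = 2 := by
      intro u hxu huw
      have hwx : w ≠ x := by rintro rfl; simp at hw
      obtain ⟨c, nu⟩ := exists_nbr3_of_adj (h.degree_three_of_adj_two n.degree hxu) hxu.symm huw
        hwx.symm
      exact h.exists_adj_degree_two n.degree nu
    have : ∃ t, G.Adj w t ∧ G.degree t = 2 := by
      simp only [Finset.mem_insert, Finset.mem_singleton, not_or] at hu hw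
      rcases hu with rfl | rfl | rfl
      · rcases (n.adj_iff w).1 huw with rfl | rfl <;> simp at hw
      · exact step _ n.adj₁ huw
      · exact step _ n.adj₂ huw
    obtain ⟨t, hwt, ht⟩ := this
    obtain ⟨c, nt⟩ := exists_nbr2 ht hwt.symm
    exact ⟨_, _, ⟨t, w, c, nt, rfl, rfl⟩, by simp⟩
  · obtain ⟨y, hy⟩ := exists_adj_of_degree_pos (G := G) (v := x) (by omega)
    obtain ⟨z, n⟩ := exists_nbr2 hx hy
    exact ⟨_, _, ⟨x, y, z, n, rfl, rfl⟩, by simp⟩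

theorem elim (h : G.IsMinCounterexample) : False := by
  have hd : ∀ v, G.degree v = 3 := by
    intro v
    have h1 := h.two_le_degree v
    have h2 := h.degree_le v
    by_contra h3
    exact h.degree_ne_two (x := v) (by omega)
  rcases isEmpty_or_nonempty V with hV | ⟨⟨v⟩⟩
  · have := h.not_light ∅ ⟨fun v => hV.elim v, by simp⟩
    simp at this
  · obtain ⟨a, ha⟩ := exists_adj_of_degree_pos (v := v) (by rw [hd]; omega)
    obtain ⟨b, c, nv⟩ := exists_nbr3 (hd v) ha
    obtain ⟨a1, a2, na⟩ := exists_nbr3 (hd a) nv.adj₁.symm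
    obtain ⟨b1, b2, nb⟩ := exists_nbr3 (hd b) nv.adj₂.symm
    obtain ⟨c1, c2, nc⟩ := exists_nbr3 (hd c) nv.adj₃.symm
    have := h.single3 nv na.outList nb.outList nc.outList
    simp [hd, degWeight] at this

end IsMinCounterexample

/-! ### From the minimal counterexample to the bound. -/

theorem HasNoFourCycle.eq_or_eq {V : Type*} {G : SimpleGraph V} (h : G.HasNoFourCycle)
    (a b c d : V) (hab : G.Adj a b) (hbc : G.Adj b c) (hcd : G.Adj c d) (hda : G.Adj d a) :
    a = c ∨ b = d := by
  by_contra! hne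
  refine h a (.cons hab (.cons hbc (.cons hcd (.cons hda .nil)))) ?_ (by simp)
  have h1 := hab.ne
  have h2 := hbc.ne
  have h3 := hcd.ne
  have h4 := hda.ne
  simp [Walk.cons_isCycle_iff, Walk.cons_isPath_iff, h1.symm, h2, h3, h4, h4.symm,
    hne.1.symm, hne.1, hne.2]

theorem hasNoFourCycle_of_eq_or_eq {V : Type*} {G : SimpleGraph V}
    (h : ∀ a b c d, G.Adj a b → G.Adj b c → G.Adj c d → G.Adj d a → a = c ∨ b = d) :
    G.HasNoFourCycle := by
  intro v p hp hlen
  match p, hp, hlen with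
  | .cons hab (.cons hbc (.cons hcd (.cons hda .nil))), hp, _ =>
    have h1 := hp.support_nodup
    simp at h1
    rcases h _ _ _ _ hab hbc hcd hda with h2 | h2
    · exact h1.2.1.2 h2.symm
    · exact h1.1.2.1 h2

open Classical in
theorem exists_light_isIndepDominatingSet (n : ℕ) : ∀ (V : Type*) [Fintype V] (G : SimpleGraph V),
    Fintype.card V = n → (∀ v, G.degree v ≤ 3) →
    (∀ a b c d, G.Adj a b → G.Adj b c → G.Adj c d → G.Adj d a → a = c ∨ b = d) →
    ∃ D : Finset V, G.IsIndepDominatingSet D ∧ 14 * D.card ≤ ∑ v, degWeight (G.degree v) := by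
  induction n using Nat.strong_induction_on with
  | _ n ih =>
  intro V _ G hn hdeg hc4
  by_contra! hno
  refine IsMinCounterexample.elim (G := G) ⟨hdeg, hc4, hno, fun U hU => ?_⟩
  let W := {v : V // v ∉ U}
  -- This is the induced subgraph G - U, in which v has degree |N(v) \ U|; the induction hypothesis
  -- for it is the field `smaller`.
  let H : SimpleGraph W := G.comap Subtype.val
  have hcard : Fintype.card W < n := by
    obtain ⟨u, hu⟩ := hU
    rw [← hn]
    exact Fintype.card_subtype_lt (x := u) (by simpa using hu)
  have hH : ∀ (w : W) [Fintype (H.neighborSet w)], H.degree w = (G.neighborFinset w.1 \ U).card := by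
    intro w _
    rw [← card_neighborFinset_eq_degree, ← Finset.card_map (Function.Embedding.subtype _)]
    congr 1
    ext z
    simp [H, W, and_comm]
  obtain ⟨D, ⟨hD1, hD2⟩, hD3⟩ := ih _ hcard W H rfl
    (fun w => by
      rw [hH]
      refine (Finset.card_le_card Finset.sdiff_subset).trans ?_
      rw [card_neighborFinset_eq_degree]
      exact hdeg _)
    (fun a b c d h1 h2 h3 h4 =>
      (hc4 a.1 b.1 c.1 d.1 h1 h2 h3 h4).imp Subtype.ext Subtype.ext)
  refine ⟨D.map (Function.Embedding.subtype _), ?_, ?_, ?_, ?_⟩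
  · rw [Finset.disjoint_left]
    intro v hv
    obtain ⟨w, -, rfl⟩ := Finset.mem_map.1 hv
    exact w.2
  · intro v hv w hw hvw
    obtain ⟨v, hv', rfl⟩ := Finset.mem_map.1 hv
    obtain ⟨w, hw', rfl⟩ := Finset.mem_map.1 hw
    exact hD2 hv' hw' (fun h => G.loopless.irrefl _ (h ▸ hvw)) hvw
  · intro v hv hvD
    obtain ⟨w, hw, hvw⟩ := hD1 ⟨v, hv⟩ (fun h => hvD (Finset.mem_map.2 ⟨_, h, rfl⟩))
    exact ⟨w.1, Finset.mem_map.2 ⟨w, hw, rfl⟩, hvw⟩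
  · rw [Finset.card_map]
    refine hD3.trans (le_of_eq ?_)
    refine (Finset.sum_congr rfl fun w _ => congrArg degWeight (hH w)).trans ?_
    rw [← Finset.sum_subtype (Uᶜ) (fun v => Finset.mem_compl)
      (fun v => degWeight (G.neighborFinset v \ U).card)]

theorem sum_degWeight {V : Type*} [Fintype V] (G : SimpleGraph V) [DecidableRel G.Adj]
    (hdeg : ∀ v, G.degree v ≤ 3) : ∑ v, degWeight (G.degree v) =
      14 * G.numVertsOfDegree 0 + 9 * G.numVertsOfDegree 1 + 6 * G.numVertsOfDegree 2 +
        5 * G.numVertsOfDegree 3 := by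
  simp only [numVertsOfDegree, Finset.card_filter, Finset.mul_sum, ← Finset.sum_add_distrib]
  refine Finset.sum_congr rfl fun v _ => ?_
  have h1 := hdeg v
  have h2 : G.degree v = 0 ∨ G.degree v = 1 ∨ G.degree v = 2 ∨ G.degree v = 3 := by omega
  rcases h2 with h2 | h2 | h2 | h2 <;> simp [h2, degWeight]

theorem IsIndepDominatingSet.indepDominationNumber_le {V : Type*} [Finite V] {G : SimpleGraph V}
    {D : Finset V} (hD : G.IsIndepDominatingSet D) : G.indepDominationNumber ≤ D.card :=
  Nat.sInf_le ⟨D, hD, rfl⟩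

theorem indepDominationNumber_bound {V : Type*} [Fintype V] (G : SimpleGraph V)
    [DecidableRel G.Adj] (hsub : G.IsSubcubic) (hc4 : G.HasNoFourCycle) :
    14 * G.indepDominationNumber ≤
      14 * G.numVertsOfDegree 0 + 9 * G.numVertsOfDegree 1 + 6 * G.numVertsOfDegree 2 +
        5 * G.numVertsOfDegree 3 := by
  have hsub' : ∀ v, G.degree v ≤ 3 := hsub
  obtain ⟨D, hD, hle⟩ := exists_light_isIndepDominatingSet _ V G rfl
    (fun v => by convert hsub' v) hc4.eq_or_eq
  rw [← sum_degWeight G hsub']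
  have := hD.indepDominationNumber_le
  refine (Nat.mul_le_mul_left 14 this).trans (hle.trans (le_of_eq ?_))
  exact Finset.sum_congr rfl fun v _ => by congr!

/-! ### The extremal graphs T. -/

section TGraph

variable {k l : ℕ}

theorem cycleGraph_adj_iff_val {n : ℕ} (hn : 3 ≤ n) (a b : Fin n) :
    (cycleGraph n).Adj a b ↔ a.val + 1 = b.val ∨ b.val + 1 = a.val ∨
      (a.val = 0 ∧ b.val + 1 = n) ∨ (b.val = 0 ∧ a.val + 1 = n) := by
  have key : ∀ u v : Fin n, (u - v).val = 1 ↔ v.val + 1 = u.val ∨ (u.val = 0 ∧ v.val + 1 = n) := by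
    intro u v
    rcases le_or_gt v u with h | h
    · rw [Fin.sub_val_of_le h]
      have := Fin.le_def.1 h
      omega
    · rw [Fin.coe_sub_iff_lt.2 h]
      have := Fin.lt_def.1 h
      omega
  rw [cycleGraph_adj', key, key]
  tauto

theorem T_adj_inl_inl (hkl : 5 ≤ k + l) (a b : Fin (k + 4 * l)) :
    (T k l).Adj (.inl a) (.inl b) ↔ a.val + 1 = b.val ∨ b.val + 1 = a.val ∨
      (a.val = 0 ∧ b.val + 1 = k + 4 * l) ∨ (b.val = 0 ∧ a.val + 1 = k + 4 * l) := by
  rw [← cycleGraph_adj_iff_val (by omega)]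
  simp only [T, fromRel_adj, TRel, ne_eq, Sum.inl.injEq, (cycleGraph (k + 4 * l)).adj_comm b a,
    or_self, and_iff_right_iff_imp]
  exact fun h => h.ne

theorem T_adj_inl_pendent (a : Fin (k + 4 * l)) (j : Fin k) :
    (T k l).Adj (.inl a) (.inr (.inl j)) ↔ a.val = j.val := by
  simp [T, TRel]

theorem T_adj_pendent_inl (a : Fin (k + 4 * l)) (j : Fin k) :
    (T k l).Adj (.inr (.inl j)) (.inl a) ↔ a.val = j.val := by
  simp [T, TRel]

theorem T_adj_inl_chord (a : Fin (k + 4 * l)) (i : Fin l) :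
    (T k l).Adj (.inl a) (.inr (.inr i)) ↔
      a.val = k + 4 * i.val ∨ a.val = k + 4 * i.val + 3 := by
  simp [T, TRel]

theorem T_adj_chord_inl (a : Fin (k + 4 * l)) (i : Fin l) :
    (T k l).Adj (.inr (.inr i)) (.inl a) ↔
      a.val = k + 4 * i.val ∨ a.val = k + 4 * i.val + 3 := by
  simp [T, TRel]

theorem T_adj_inr_inr (a b : Fin k ⊕ Fin l) : ¬ (T k l).Adj (.inr a) (.inr b) := by
  rcases a with a | a <;> rcases b with b | b <;> simp [T, TRel]

theorem T_hasNoFourCycle (hkl : 5 ≤ k + l) : (T k l).HasNoFourCycle := by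
  refine hasNoFourCycle_of_eq_or_eq fun a b c d hab hbc hcd hda => ?_
  rcases a with a | a | a <;> rcases b with b | b | b <;> rcases c with c | c | c <;>
    rcases d with d | d | d <;>
    simp only [T_adj_inl_inl hkl, T_adj_inl_pendent, T_adj_pendent_inl, T_adj_inl_chord,
      T_adj_chord_inl, T_adj_inr_inr, Sum.inl.injEq, Sum.inr.injEq, Fin.ext_iff, reduceCtorEq,
      or_false, false_or] at * <;> omega

/-- The degree of the cycle vertex with index `m` in `T_{k,ℓ}`. -/
def cycleVertexDegree (k m : ℕ) : ℕ :=
  if m < k ∨ (m - k) % 4 = 0 ∨ (m - k) % 4 = 3 then 3 else 2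

theorem T_degree_pendent (j : Fin k) : (T k l).degree (.inr (.inl j)) = 1 := by
  refine Nbr1.degree (a := .inl ⟨j.val, by omega⟩) ⟨fun z => ?_⟩
  rcases z with z | z | z
  · simp [T_adj_pendent_inl, Fin.ext_iff]
  · simp [T_adj_inr_inr]
  · simp [T_adj_inr_inr]

theorem T_degree_chord (i : Fin l) : (T k l).degree (.inr (.inr i)) = 2 := by
  have h0 : k + 4 * i.val < k + 4 * l := by omega
  have h3 : k + 4 * i.val + 3 < k + 4 * l := by omega
  refine Nbr2.degree (a := .inl ⟨_, h0⟩) (b := .inl ⟨_, h3⟩) ⟨by simp [Fin.ext_iff], fun z => ?_⟩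
  rcases z with z | z | z
  · simp [T_adj_chord_inl, Fin.ext_iff]
  · simp [T_adj_inr_inr]
  · simp [T_adj_inr_inr]

theorem T_degree_inl (hkl : 5 ≤ k + l) (a : Fin (k + 4 * l)) :
    (T k l).degree (.inl a) = cycleVertexDegree k a.val := by
  have ha := a.isLt
  let b : Fin (k + 4 * l) := ⟨if a.val + 1 = k + 4 * l then 0 else a.val + 1, by split_ifs <;> omega⟩
  let c : Fin (k + 4 * l) := ⟨if a.val = 0 then k + 4 * l - 1 else a.val - 1, by
    split_ifs <;> omega⟩
  have hb : b.val = if a.val + 1 = k + 4 * l then 0 else a.val + 1 := rfl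
  have hc : c.val = if a.val = 0 then k + 4 * l - 1 else a.val - 1 := rfl
  have hbc : b ≠ c := by
    rw [ne_eq, Fin.ext_iff, hb, hc]
    split_ifs <;> omega
  have hinl : ∀ z : Fin (k + 4 * l), (T k l).Adj (.inl a) (.inl z) ↔ z = b ∨ z = c := by
    intro z
    have hz := z.isLt
    rw [T_adj_inl_inl hkl, Fin.ext_iff, Fin.ext_iff, hb, hc]
    split_ifs <;> omega
  rw [cycleVertexDegree]
  by_cases h1 : a.val < k
  · rw [if_pos (.inl h1)]
    refine Nbr3.degree (a := .inl b) (b := .inl c) (c := .inr (.inl ⟨a.val, h1⟩))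
      ⟨by simpa using hbc, by simp, by simp, fun z => ?_⟩
    rcases z with z | z | z
    · simp [hinl]
    · simp [T_adj_inl_pendent, Fin.ext_iff, eq_comm]
    · simp [T_adj_inl_chord]
      omega
  by_cases h2 : (a.val - k) % 4 = 0 ∨ (a.val - k) % 4 = 3
  · rw [if_pos (.inr h2)]
    refine Nbr3.degree (a := .inl b) (b := .inl c) (c := .inr (.inr ⟨(a.val - k) / 4, by omega⟩))
      ⟨by simpa using hbc, by simp, by simp, fun z => ?_⟩
    rcases z with z | z | z
    · simp [hinl]
    · simp [T_adj_inl_pendent]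
      omega
    · simp [T_adj_inl_chord, Fin.ext_iff]
      omega
  · rw [if_neg (by tauto)]
    refine Nbr2.degree (a := .inl b) (b := .inl c) ⟨by simpa using hbc, fun z => ?_⟩
    rcases z with z | z | z
    · simp [hinl]
    · simp [T_adj_inl_pendent]
      omega
    · simp [T_adj_inl_chord]
      omega

theorem T_isSubcubic (hkl : 5 ≤ k + l) : (T k l).IsSubcubic := by
  intro v
  rcases v with a | j | i
  · rw [T_degree_inl hkl, cycleVertexDegree]
    split_ifs <;> omega
  · rw [T_degree_pendent]; omega
  · rw [T_degree_chord]; omega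

theorem T_numVertsOfDegree (hkl : 5 ≤ k + l) (d : ℕ) : (T k l).numVertsOfDegree d =
    (∑ m ∈ Finset.range (k + 4 * l), if cycleVertexDegree k m = d then 1 else 0) +
      ((if 1 = d then k else 0) + if 2 = d then l else 0) := by
  rw [numVertsOfDegree, Finset.card_filter, Fintype.sum_sum_type, Fintype.sum_sum_type,
    ← Fin.sum_univ_eq_sum_range (fun m => if cycleVertexDegree k m = d then 1 else 0)]
  simp only [T_degree_inl hkl, T_degree_pendent, T_degree_chord]
  congr 2
  · split_ifs <;> simp
  · split_ifs <;> simp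

theorem sum_cycleVertexDegree (k l d : ℕ) :
    (∑ m ∈ Finset.range (k + 4 * l), if cycleVertexDegree k m = d then 1 else 0) =
      (if 3 = d then k + 2 * l else 0) + if 2 = d then 2 * l else 0 := by
  induction l with
  | zero =>
    have h : ∀ m ∈ Finset.range (k + 4 * 0),
        (if cycleVertexDegree k m = d then 1 else 0) = if 3 = d then 1 else 0 := by
      intro m hm
      have h3 : cycleVertexDegree k m = 3 := if_pos (.inl (by simpa using hm))
      rw [h3]
    rw [Finset.sum_congr rfl h]
    split_ifs <;> simp
  | succ l ih =>
    have h0 : cycleVertexDegree k (k + 4 * l) = 3 := if_pos (by omega)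
    have h1 : cycleVertexDegree k (k + 4 * l + 1) = 2 := if_neg (by omega)
    have h2 : cycleVertexDegree k (k + 4 * l + 2) = 2 := if_neg (by omega)
    have h3 : cycleVertexDegree k (k + 4 * l + 3) = 3 := if_pos (by omega)
    rw [show k + 4 * (l + 1) = k + 4 * l + 3 + 1 by ring, Finset.sum_range_succ,
      Finset.sum_range_succ, Finset.sum_range_succ, Finset.sum_range_succ, ih, h0, h1, h2, h3]
    split_ifs <;> omega

theorem T_connected (hkl : 5 ≤ k + l) : (T k l).Connected := by
  let f : cycleGraph (k + 4 * l) →g T k l :=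
    ⟨Sum.inl, fun {a b} h => by
      rw [T_adj_inl_inl hkl, ← cycleGraph_adj_iff_val (by omega)]; exact h⟩
  let o : Fin (k + 4 * l) := ⟨0, by omega⟩
  have hinl : ∀ a, (T k l).Reachable (.inl a) (.inl o) := fun a =>
    (cycleGraph_preconnected a o).map f
  have hall : ∀ v, (T k l).Reachable v (.inl o) := by
    intro v
    rcases v with a | j | i
    · exact hinl a
    · have h := (T_adj_pendent_inl (l := l) ⟨j.val, by omega⟩ j).2 rfl
      exact h.reachable.trans (hinl _)
    · have h := (T_adj_chord_inl (k := k) ⟨k + 4 * i.val, by omega⟩ i).2 (.inl rfl)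
      exact h.reachable.trans (hinl _)
  exact { preconnected := fun u v => (hall u).trans (hall v).symm, nonempty := ⟨.inl o⟩ }

/-- The pendent edge or five-cycle of `T_{k,ℓ}` to which a vertex belongs. -/
def TUnit (k l : ℕ) : TVertex k l → Fin k ⊕ Fin l
  | .inl a => if h : a.val < k then .inl ⟨a.val, h⟩ else .inr ⟨(a.val - k) / 4, by omega⟩
  | .inr v => v

theorem TUnit_inl_of_eq (a : Fin (k + 4 * l)) (i : Fin l) (r : ℕ) (hr : r < 4)
    (h : a.val = k + 4 * i.val + r) : TUnit k l (.inl a) = .inr i := by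
  rw [TUnit, dif_neg (by omega), Sum.inr.injEq, Fin.ext_iff]
  simp only
  omega

/-- The fibers of `TUnit` are the pendent edges and the five-cycles. The pendent vertex forces one
element in its fiber. In a five-cycle, the three vertices of degree two have all neighbors inside,
and no single vertex dominates all three. -/
theorem card_le_of_isDominatingSet_T (hkl : 5 ≤ k + l) {D : Finset (TVertex k l)}
    (hD : (T k l).IsDominatingSet D) : k + 2 * l ≤ D.card := by
  rw [Finset.card_eq_sum_card_fiberwise (f := TUnit k l) (t := Finset.univ) (fun _ _ => by simp),
    Fintype.sum_sum_type]
  refine add_le_add ?_ ?_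
  · refine le_trans (by simp) (Finset.card_nsmul_le_sum Finset.univ _ 1 fun j _ => ?_)
    rw [Nat.one_le_iff_ne_zero, ← Nat.pos_iff_ne_zero, Finset.card_pos]
    by_cases hj : (.inr (.inl j) : TVertex k l) ∈ D
    · exact ⟨_, Finset.mem_filter.2 ⟨hj, rfl⟩⟩
    · obtain ⟨w, hw, hadj⟩ := hD _ hj
      refine ⟨w, Finset.mem_filter.2 ⟨hw, ?_⟩⟩
      rcases w with a | w
      · rw [T_adj_pendent_inl] at hadj
        rw [TUnit, dif_pos (by omega), Sum.inl.injEq, Fin.ext_iff]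
        exact hadj
      · exact absurd hadj (T_adj_inr_inr _ _)
  · refine le_trans (by simp [mul_comm]) (Finset.card_nsmul_le_sum Finset.univ _ 2 fun i _ => ?_)
    have hi := i.isLt
    have hmid : ∀ r, r = 1 ∨ r = 2 → ∃ a : Fin (k + 4 * l), .inl a ∈ D ∧
        (a.val = k + 4 * i.val + (r - 1) ∨ a.val = k + 4 * i.val + r ∨
          a.val = k + 4 * i.val + (r + 1)) := by
      intro r hr
      let x : Fin (k + 4 * l) := ⟨k + 4 * i.val + r, by omega⟩
      have hx : x.val = k + 4 * i.val + r := rfl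
      by_cases hxD : (.inl x : TVertex k l) ∈ D
      · exact ⟨x, hxD, .inr (.inl rfl)⟩
      · obtain ⟨w, hw, hadj⟩ := hD _ hxD
        rcases w with a | j | i'
        · have := a.isLt
          rw [T_adj_inl_inl hkl] at hadj
          exact ⟨a, hw, by omega⟩
        · rw [T_adj_inl_pendent] at hadj
          omega
        · rw [T_adj_inl_chord] at hadj
          omega
    have hend : (.inr (.inr i) : TVertex k l) ∈ D ∨ ∃ a : Fin (k + 4 * l), .inl a ∈ D ∧
        (a.val = k + 4 * i.val ∨ a.val = k + 4 * i.val + 3) := by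
      by_cases hiD : (.inr (.inr i) : TVertex k l) ∈ D
      · exact .inl hiD
      · obtain ⟨w, hw, hadj⟩ := hD _ hiD
        rcases w with a | w
        · rw [T_adj_chord_inl] at hadj
          exact .inr ⟨a, hw, hadj⟩
        · exact absurd hadj (T_adj_inr_inr _ _)
    obtain ⟨a, haD, ha⟩ := hmid 1 (.inl rfl)
    obtain ⟨b, hbD, hb⟩ := hmid 2 (.inr rfl)
    have hfib : ∀ c : Fin (k + 4 * l), .inl c ∈ D →
        (∃ r < 4, c.val = k + 4 * i.val + r) →
        .inl c ∈ D.filter (fun v => TUnit k l v = .inr i) := by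
      rintro c hc ⟨r, hr, h⟩
      exact Finset.mem_filter.2 ⟨hc, TUnit_inl_of_eq c i r hr h⟩
    have haF := hfib a haD ⟨a.val - (k + 4 * i.val), by omega, by omega⟩
    have hbF := hfib b hbD ⟨b.val - (k + 4 * i.val), by omega, by omega⟩
    -- If the further vertex is dominated by the first vertex of the block, that vertex does not
    -- dominate position 2; if by the last one, that does not dominate position 1. Either way a
    -- second element appears.
    refine Finset.one_lt_card.2 ?_
    rcases hend with hy | ⟨c, hcD, hc⟩
    · exact ⟨_, haF, _, Finset.mem_filter.2 ⟨hy, rfl⟩, by simp⟩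
    · have hcF := hfib c hcD ⟨c.val - (k + 4 * i.val), by omega, by omega⟩
      rcases hc with hc | hc
      · exact ⟨_, hcF, _, hbF, by rw [ne_eq, Sum.inl.injEq, Fin.ext_iff]; omega⟩
      · exact ⟨_, hcF, _, haF, by rw [ne_eq, Sum.inl.injEq, Fin.ext_iff]; omega⟩

theorem le_indepDominationNumber_T (hkl : 5 ≤ k + l) :
    k + 2 * l ≤ (T k l).indepDominationNumber := by
  obtain ⟨D₀, hD₀⟩ := (T k l).exists_isIndepDominatingSet
  obtain ⟨D, hD, hcard⟩ := Nat.sInf_mem (s := {n | ∃ S : Finset (TVertex k l),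
    (T k l).IsIndepDominatingSet S ∧ S.card = n}) ⟨_, D₀, hD₀, rfl⟩
  rw [indepDominationNumber, ← hcard]
  exact card_le_of_isDominatingSet_T hkl hD.1

end TGraph

end SimpleGraph

theorem mainTheorem1 :
    (∀ (V : Type*) [Fintype V] (G : SimpleGraph V) [DecidableRel G.Adj],
      G.IsSubcubic → G.HasNoFourCycle →
        14 * G.indepDominationNumber ≤
          14 * G.numVertsOfDegree 0 + 9 * G.numVertsOfDegree 1
            + 6 * G.numVertsOfDegree 2 + 5 * G.numVertsOfDegree 3) ∧
    (∀ k l : ℕ, 5 ≤ k + l →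
      (SimpleGraph.T k l).IsSubcubic ∧
      (SimpleGraph.T k l).HasNoFourCycle ∧
      (SimpleGraph.T k l).Connected ∧
      (SimpleGraph.T k l).numVertsOfDegree 0 = 0 ∧
      (SimpleGraph.T k l).numVertsOfDegree 1 = k ∧
      (SimpleGraph.T k l).numVertsOfDegree 2 = 3 * l ∧
      (SimpleGraph.T k l).numVertsOfDegree 3 = k + 2 * l ∧
      (SimpleGraph.T k l).indepDominationNumber = k + 2 * l ∧
      14 * (SimpleGraph.T k l).indepDominationNumber =
        14 * (SimpleGraph.T k l).numVertsOfDegree 0 + 9 * (SimpleGraph.T k l).numVertsOfDegree 1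
          + 6 * (SimpleGraph.T k l).numVertsOfDegree 2
          + 5 * (SimpleGraph.T k l).numVertsOfDegree 3) := by
  refine ⟨fun V _ G _ hsub hc4 => G.indepDominationNumber_bound hsub hc4, fun k l hkl => ?_⟩
  have hsub := SimpleGraph.T_isSubcubic hkl
  have hc4 := SimpleGraph.T_hasNoFourCycle hkl
  have h0 : (SimpleGraph.T k l).numVertsOfDegree 0 = 0 := by
    rw [SimpleGraph.T_numVertsOfDegree hkl, SimpleGraph.sum_cycleVertexDegree]
    simp
  have h1 : (SimpleGraph.T k l).numVertsOfDegree 1 = k := by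
    rw [SimpleGraph.T_numVertsOfDegree hkl, SimpleGraph.sum_cycleVertexDegree]
    simp
  have h2 : (SimpleGraph.T k l).numVertsOfDegree 2 = 3 * l := by
    rw [SimpleGraph.T_numVertsOfDegree hkl, SimpleGraph.sum_cycleVertexDegree]
    simp
    omega
  have h3 : (SimpleGraph.T k l).numVertsOfDegree 3 = k + 2 * l := by
    rw [SimpleGraph.T_numVertsOfDegree hkl, SimpleGraph.sum_cycleVertexDegree]
    simp
  -- The bound itself gives i(T) ≤ k + 2l, as 9k + 6 · 3l + 5(k + 2l) = 14(k + 2l); no dominating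
  -- set needs to be exhibited.
  have hle := (SimpleGraph.T k l).indepDominationNumber_bound hsub hc4
  have hge := SimpleGraph.le_indepDominationNumber_T hkl
  refine ⟨hsub, hc4, SimpleGraph.T_connected hkl, h0, h1, h2, h3, ?_, ?_⟩ <;> omega
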